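/- Let $\alpha$ be a positive irrational number. Let $\mathbb T$ be the unit circle in $\mathbb C$, let $\mu$ be normalized Lebesgue measure on $\mathbb T^2$, and let $\mathcal A_\alpha$ be the Banach algebra (with the supremum norm) of all continuous functions $f:\mathbb T^2\to\mathbb C$ such that $$\hat f(m,n)=\int_{\mathbb T^2} f(z,w)\,z^{-m}w^{-n}\,d\mu(z,w)=0\quad\text{for all } m,n\in\mathbb Z \text{ with } m+\alpha n<0 .$$ Let $\operatorname{Aut}(\mathcal A_\alpha)$ be the group, under composition, of all isometric $\mathbb C$-algebra automorphisms of $\mathcal A_\alpha$. For $c=(c_1,c_2)\in\mathbb T^2$ call the automorphism $f\mapsto\bigl((z,w)\mapsto f(c_1z,c_2w)\bigr)$ the rotation by $c$. A quadratic irrational is an irrational real number that is a root of a quadratic polynomial with integer coefficients. For $A=\begin{pmatrix}a&b\\c&d\end{pmatrix}\in GL(2,\mathbb Z)$ let $\psi_A$ be the automorphism $(c_1,c_2)\mapsto(c_1^{a}c_2^{b},\,c_1^{c}c_2^{d})$ of $\mathbb T^2$, and let $\mathbb T^2\rtimes_{\psi_A}\mathbb Z$ be the group with underlying set $\mathbb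 T^2\times\mathbb Z$ and multiplication $(\mathbf c,m)(\mathbf d,n)=(\mathbf c\,\psi_A^m(\mathbf d),\,m+n)$. 1. If $\alpha$ is not a quadratic irrational, then $\operatorname{Aut}(\mathcal A_\alpha)\cong\mathbb T^2$ as groups, by an isomorphism under which $c\in\mathbb T^2$ corresponds to the rotation by $c$. 2. If $\alpha$ is a quadratic irrational, then there is a non-identity matrix $A\in GL(2,\mathbb Z)$ such that $\operatorname{Aut}(\mathcal A_\alpha)\cong\mathbb T^2\rtimes_{\psi_A}\mathbb Z$ as groups, by an isomorphism under which $(c,0)$, for $c\in\mathbb T^2$, corresponds to the rotation by $c$. -/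

import Mathlib

open UnitAddTorus in
/-- Convolution of Fourier coefficients: if for every `k` one of `f̂ (n - k)`, `ĝ k` vanishes, then
the `n`-th Fourier coefficient of `f g` vanishes. -/
theorem mFourierCoeff_mul_eq_zero (f g : C(UnitAddTorus (Fin 2), ℂ)) (n : Fin 2 → ℤ)
    (h : ∀ k, mFourierCoeff f (n - k) = 0 ∨ mFourierCoeff g k = 0) :
    mFourierCoeff (f * g) n = 0 := by
  let _ : MeasureTheory.MeasureSpace UnitAddCircle := ⟨AddCircle.haarAddCircle⟩
  have _ : MeasureTheory.IsProbabilityMeasure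
      (MeasureTheory.volume : MeasureTheory.Measure UnitAddCircle) :=
    inferInstanceAs (MeasureTheory.IsProbabilityMeasure AddCircle.haarAddCircle)
  let F : C(UnitAddTorus (Fin 2), ℂ) := mFourier n * star f
  have key := hasSum_prod_mFourierCoeff (ContinuousMap.toLp 2 MeasureTheory.volume ℂ F) (ContinuousMap.toLp 2 MeasureTheory.volume ℂ g)
  have hF : ∀ k, (starRingEnd ℂ) (mFourierCoeff F k) = mFourierCoeff f (n - k) := by
    intro k
    unfold mFourierCoeff
    rw [← integral_conj]
    congr 1
    ext t
    have h1 : mFourier (-(n - k)) t = mFourier k t * mFourier (-n) t := by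
      rw [← mFourier_add]; congr 2; abel
    rw [h1]
    simp [F, mFourier_neg, mul_assoc]
  have hz : ∀ k, (starRingEnd ℂ) (mFourierCoeff (ContinuousMap.toLp 2 MeasureTheory.volume ℂ F) k) *
      mFourierCoeff (ContinuousMap.toLp 2 MeasureTheory.volume ℂ g) k = 0 := by
    intro k
    rw [mFourierCoeff_toLp, mFourierCoeff_toLp, hF]
    rcases h k with h | h <;> simp [h]
  have h0 := (HasSum.congr_fun hasSum_zero hz).unique key
  refine Eq.trans ?_ h0.symm
  refine MeasureTheory.integral_congr_ae ?_
  filter_upwards [ContinuousMap.coeFn_toLp (𝕜 := ℂ) (p := 2) MeasureTheory.volume F,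
    ContinuousMap.coeFn_toLp (𝕜 := ℂ) (p := 2) MeasureTheory.volume g] with t h1 h2
  rw [h1, h2]
  simp [F, mFourier_neg, mul_assoc]

/-- The multiplicative 2-torus `𝕋² = 𝕋 × 𝕋`, with `𝕋` the unit circle in `ℂ`. -/
abbrev Torus2 : Type := Circle × Circle

/-- The parametrization `(x, y) ↦ (e^{2πix}, e^{2πiy})` of `𝕋²` by `(ℝ/ℤ)²`. -/
noncomputable def torusParam : C(UnitAddTorus (Fin 2), Torus2) where
  toFun x := (AddCircle.toCircle (x 0), AddCircle.toCircle (x 1))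
  continuous_toFun := by fun_prop

/-- The Fourier coefficient `f̂(m, n) = ∫ f(z, w) z^{-m} w^{-n} dμ` of a continuous function on
`𝕋²`, where `μ` is the normalized Lebesgue measure; the integral is taken in the parametrization
of `𝕋²` by `(ℝ/ℤ)²` with its Haar probability measure. -/
noncomputable def fourierCoeffTorus (f : C(Torus2, ℂ)) (m n : ℤ) : ℂ :=
  UnitAddTorus.mFourierCoeff (f.comp torusParam) ![m, n]

theorem fourierCoeffTorus_add (f g : C(Torus2, ℂ)) (m n : ℤ) :
    fourierCoeffTorus (f + g) m n = fourierCoeffTorus f m n + fourierCoeffTorus g m n := by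
  have key := fun h : C(Torus2, ℂ) =>
    (UnitAddTorus.mFourierCoeff_toLp (h.comp torusParam) ![m, n]).symm
  simp only [← UnitAddTorus.mFourierBasis_repr] at key
  have hfg : (f + g).comp torusParam = f.comp torusParam + g.comp torusParam := rfl
  unfold fourierCoeffTorus
  rw [key, key, key, hfg, map_add, map_add]
  rfl

theorem fourierCoeffTorus_algebraMap (r : ℂ) (m n : ℤ) (h : m ≠ 0 ∨ n ≠ 0) :
    fourierCoeffTorus (algebraMap ℂ C(Torus2, ℂ) r) m n = 0 := by
  have h1 : (algebraMap ℂ C(Torus2, ℂ) r).comp torusParam =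
      r • UnitAddTorus.mFourier (d := Fin 2) 0 := by
    ext x
    simp [UnitAddTorus.mFourier_zero, Algebra.algebraMap_eq_smul_one]
  unfold fourierCoeffTorus
  rw [← UnitAddTorus.mFourierCoeff_toLp, h1, map_smul, ← UnitAddTorus.mFourierBasis_repr, map_smul]
  have h2 := UnitAddTorus.mFourierBasis.repr_self (0 : Fin 2 → ℤ)
  rw [UnitAddTorus.coe_mFourierBasis] at h2
  rw [h2]
  have h3 : (![m, n] : Fin 2 → ℤ) ≠ 0 := by
    intro h4
    have h5 := congrFun h4 0
    have h6 := congrFun h4 1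
    simp at h5 h6
    tauto
  simp [h3]

/-- The algebra `𝒜_α` of continuous functions `f` on `𝕋²` such that `f̂(m, n) = 0` whenever
`m + α n < 0`, as a subalgebra of `C(𝕋²)` (and so with the supremum norm). -/
noncomputable def bigDiscAlgebra (α : ℝ) : Subalgebra ℂ C(Torus2, ℂ) where
  carrier := {f | ∀ m n : ℤ, (m : ℝ) + α * n < 0 → fourierCoeffTorus f m n = 0}
  add_mem' := by
    intro f g hf hg m n h
    rw [fourierCoeffTorus_add, hf m n h, hg m n h, add_zero]
  mul_mem' := by
    intro f g hf hg m n h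
    refine mFourierCoeff_mul_eq_zero (f.comp torusParam) (g.comp torusParam) ![m, n] ?_
    intro k
    have hk : k = ![k 0, k 1] := by ext i; fin_cases i <;> rfl
    have hnk : ![m, n] - k = ![m - k 0, n - k 1] := by ext i; fin_cases i <;> rfl
    rcases lt_or_ge ((k 0 : ℝ) + α * k 1) 0 with h1 | h1
    · right
      rw [hk]
      exact hg _ _ h1
    · left
      rw [hnk]
      refine hf _ _ ?_
      push_cast
      linarith
  algebraMap_mem' := by
    intro r m n h
    refine fourierCoeffTorus_algebraMap r m n ?_
    by_contra! h0
    simp [h0.1, h0.2] at h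

/-- The group `Aut(𝒜_α)` of isometric automorphisms of the Banach algebra `𝒜_α`, under
composition. -/
def isometricAut (α : ℝ) : Subgroup (bigDiscAlgebra α ≃ₐ[ℂ] bigDiscAlgebra α) where
  carrier := {Φ | Isometry Φ}
  mul_mem' := fun hΦ hΨ => hΦ.comp hΨ
  one_mem' := isometry_id
  inv_mem' := fun {Φ} hΦ => hΦ.right_inv Φ.right_inv

/-- A quadratic irrational: an irrational real number which is a root of a quadratic polynomial
with integer coefficients. -/
def IsQuadraticIrrational (α : ℝ) : Prop :=
  Irrational α ∧ ∃ a b c : ℤ, a ≠ 0 ∧ (a : ℝ) * α ^ 2 + b * α + c = 0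

/-- The map `(c₁, c₂) ↦ (c₁^a c₂^b, c₁^c c₂^d)` on `𝕋²` given by the matrix `[[a, b], [c, d]]`. -/
noncomputable def toralMap (A : Matrix (Fin 2) (Fin 2) ℤ) (c : Torus2) : Torus2 :=
  (c.1 ^ A 0 0 * c.2 ^ A 0 1, c.1 ^ A 1 0 * c.2 ^ A 1 1)

theorem toralMap_one (c : Torus2) : toralMap 1 c = c := by
  simp [toralMap]

theorem toralMap_mul (A B : Matrix (Fin 2) (Fin 2) ℤ) (c : Torus2) :
    toralMap (A * B) c = toralMap A (toralMap B c) := by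
  ext1 <;>
  · simp only [toralMap, Matrix.mul_apply, Fin.sum_univ_two, mul_zpow, ← zpow_mul, zpow_add,
      mul_comm (B _ _)]
    exact mul_mul_mul_comm _ _ _ _

/-- The toral automorphism `ψ_A` of the group `𝕋²` given by `A ∈ GL(2, ℤ)`. -/
noncomputable def toralAut (A : Matrix.GeneralLinearGroup (Fin 2) ℤ) : MulAut Torus2 where
  toFun := toralMap A.1
  invFun := toralMap A⁻¹.1
  left_inv c := by rw [← toralMap_mul, ← Units.val_mul, inv_mul_cancel, Units.val_one, toralMap_one]
  right_inv c := by
    rw [← toralMap_mul, ← Units.val_mul, mul_inv_cancel, Units.val_one, toralMap_one]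
  map_mul' c d := by
    ext1 <;>
    · simp only [toralMap, Prod.fst_mul, Prod.snd_mul, mul_zpow]
      exact mul_mul_mul_comm _ _ _ _

/-- The semidirect product `𝕋² ⋊_{ψ_A} ℤ`, with multiplication
`(c, m) (d, n) = (c ψ_A^m(d), m + n)`. -/
abbrev TorusSemidirect (A : Matrix.GeneralLinearGroup (Fin 2) ℤ) : Type :=
  SemidirectProduct Torus2 (Multiplicative ℤ) (zpowersHom (MulAut Torus2) (toralAut A))

/-- The automorphism `Φ` is the rotation by `c`, i.e. `Φ(f)(z, w) = f(c₁ z, c₂ w)`. -/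
def IsRotationBy {α : ℝ} (Φ : isometricAut α) (c : Torus2) : Prop :=
  ∀ (f : bigDiscAlgebra α) (z w : Circle),
    (Φ.1 f : C(Torus2, ℂ)) (z, w) = (f : C(Torus2, ℂ)) (c.1 * z, c.2 * w)

/-!
The functions in the algebra are those continuous functions on the torus that extend holomorphically
to half-planes along the flow `t ↦ (e^{it}, e^{iαt})`: the character `χ_k`, `k = (m, n)`, has the
frequency `weight α k = m + α n` along this flow, and the algebra is the closed span of the
characters of nonnegative weight (`mem_closure_span_of_mem_bigDiscAlgebra`, a form of Fejér's
theorem).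

The main step is that an isometric automorphism `Φ` maps every character to a multiple of a
character and multiplies all weights by a constant `κ > 0` (`exists_scalesWeights`). By a
peak function argument, `u_k = Φ(χ_k)` is unimodular. Extended to a half-plane along an orbit of the
flow, the `u_k` form a multiplicative family of inner functions, indexed by a semigroup with
arbitrarily small positive weights. By the Schwarz lemma such a family has no zeros, its
logarithmic modulus is `-(weight α k) * λ(z)` with one function `λ`, and the Schwarz–Pick lemma for
small weights is Harnack's inequality for `λ`. Together with the Phragmén–Lindelöf principle and the
maximum principle this gives `λ(z) = κ Re z` (`InnerFamily.exists_eq_mul_exp`). The constant `κ`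
depends continuously on the orbit and is invariant under the flow, so it is a global constant; hence
each `u_k` is an eigenfunction of the flow, that is, a multiple of a character
(`exists_scaling_of_unimodular`).

The automorphisms with `κ = 1` are the rotations (`exists_rotationHom_eq`). In general `κ` is a
positive unit of the ring of multipliers of the lattice `ℤ + αℤ`. If `α` is not a quadratic
irrational, then `κ = 1`. Otherwise Pell's equation yields a nontrivial `κ`, and since `κ ± κ⁻¹` is
an integer for one of the signs, these units form a discrete, hence infinite cyclic group
(`exists_fundamental_multiplier`). A generator is the eigenvalue at `(1, α)` of a matrix
`B ∈ GL(2, ℤ)`, composition with `ψ_B` is an automorphism that multiplies weights by it, and this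
splits the extension of the infinite cyclic group by the rotations, with `A = B⁻¹`.
-/

open MeasureTheory Filter Topology ComplexConjugate

/-! ### Fourier analysis on the torus -/

/-- The character `(z, w) ↦ z ^ m * w ^ n` of the torus, for `k = (m, n)`. -/
noncomputable def torusChar (k : ℤ × ℤ) : C(Torus2, ℂ) where
  toFun x := ((x.1 ^ k.1 * x.2 ^ k.2 : Circle) : ℂ)
  continuous_toFun := by
    have h : Continuous fun x : Torus2 => x.1 ^ k.1 * x.2 ^ k.2 :=
      (continuous_fst.zpow _).mul (continuous_snd.zpow _)
    exact continuous_subtype_val.comp h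

theorem torusChar_apply (k : ℤ × ℤ) (x : Torus2) :
    torusChar k x = ((x.1 ^ k.1 * x.2 ^ k.2 : Circle) : ℂ) := rfl

theorem norm_torusChar_apply (k : ℤ × ℤ) (x : Torus2) : ‖torusChar k x‖ = 1 :=
  Circle.norm_coe _

theorem torusChar_zero : torusChar 0 = 1 := by
  ext x; simp [torusChar_apply]

theorem torusChar_add (k l : ℤ × ℤ) : torusChar (k + l) = torusChar k * torusChar l := by
  ext x
  simp only [torusChar_apply, ContinuousMap.mul_apply, ← Circle.coe_mul, Prod.fst_add,
    Prod.snd_add, zpow_add]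
  rw [mul_mul_mul_comm]

theorem torusChar_apply_mul (k : ℤ × ℤ) (x y : Torus2) :
    torusChar k (x * y) = torusChar k x * torusChar k y := by
  simp only [torusChar_apply, ← Circle.coe_mul, Prod.fst_mul, Prod.snd_mul, mul_zpow]
  rw [mul_mul_mul_comm]

theorem torusChar_apply_one (k : ℤ × ℤ) : torusChar k 1 = 1 := by
  simp [torusChar_apply]

theorem norm_torusChar (k : ℤ × ℤ) : ‖torusChar k‖ = 1 :=
  le_antisymm ((ContinuousMap.norm_le _ zero_le_one).2 fun x => (norm_torusChar_apply k x).le)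
    ((norm_torusChar_apply k 1).symm.le.trans ((torusChar k).norm_coe_le_norm 1))

theorem torusChar_ne_zero (k : ℤ × ℤ) : torusChar k ≠ 0 :=
  norm_ne_zero_iff.1 (by rw [norm_torusChar]; exact one_ne_zero)

theorem torusChar_torusParam (k : ℤ × ℤ) (t : UnitAddTorus (Fin 2)) :
    torusChar k (torusParam t) = UnitAddTorus.mFourier ![k.1, k.2] t := by
  simp [torusChar_apply, torusParam, UnitAddTorus.mFourier, Fin.prod_univ_two, fourier_apply,
    AddCircle.toCircle_zsmul]

theorem torusParam_add (s t : UnitAddTorus (Fin 2)) :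
    torusParam (s + t) = torusParam s * torusParam t := by
  simp [torusParam, AddCircle.toCircle_add]

theorem torusParam_zero : torusParam 0 = 1 := by
  simp [torusParam]

theorem torusParam_surjective : Function.Surjective torusParam := by
  intro x
  refine ⟨![(AddCircle.homeomorphCircle one_ne_zero).symm x.1,
    (AddCircle.homeomorphCircle one_ne_zero).symm x.2], ?_⟩
  have h : ∀ z : Circle, AddCircle.toCircle
      ((AddCircle.homeomorphCircle (T := (1 : ℝ)) one_ne_zero).symm z) = z := fun z => by
    rw [← AddCircle.homeomorphCircle_apply one_ne_zero, Homeomorph.apply_symm_apply]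
  simp [torusParam, h]

/-- The Haar probability measure of `(ℝ/ℤ)²`. -/
noncomputable def paramHaar : Measure (UnitAddTorus (Fin 2)) :=
  Measure.pi fun _ => AddCircle.haarAddCircle

instance : IsProbabilityMeasure paramHaar := by unfold paramHaar; infer_instance

instance : paramHaar.IsAddLeftInvariant := by unfold paramHaar; infer_instance

instance : paramHaar.IsOpenPosMeasure := by unfold paramHaar; infer_instance

theorem fourierCoeffTorus_eq_integral (f : C(Torus2, ℂ)) (k : ℤ × ℤ) :
    fourierCoeffTorus f k.1 k.2 =
      ∫ t, torusChar (-k) (torusParam t) * f (torusParam t) ∂paramHaar := by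
  simp only [torusChar_torusParam]
  have h : (![(-k).1, (-k).2] : Fin 2 → ℤ) = -![k.1, k.2] := by ext i; fin_cases i <;> rfl
  rw [h]
  rfl

theorem integrable_comp_torusParam {E : Type*} [NormedAddCommGroup E]
    {g : UnitAddTorus (Fin 2) → E} (hg : Continuous g) : Integrable g paramHaar :=
  integrableOn_univ.1 (hg.continuousOn.integrableOn_compact isCompact_univ)

theorem norm_fourierCoeffTorus_le (f : C(Torus2, ℂ)) (k : ℤ × ℤ) :
    ‖fourierCoeffTorus f k.1 k.2‖ ≤ ‖f‖ := by
  rw [fourierCoeffTorus_eq_integral]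
  refine (norm_integral_le_of_norm_le_const (C := ‖f‖) (ae_of_all _ fun t => ?_)).trans ?_
  · rw [norm_mul, norm_torusChar_apply, one_mul]
    exact f.norm_coe_le_norm _
  · simp

theorem fourierCoeffTorus_smul (a : ℂ) (f : C(Torus2, ℂ)) (k : ℤ × ℤ) :
    fourierCoeffTorus (a • f) k.1 k.2 = a * fourierCoeffTorus f k.1 k.2 := by
  rw [fourierCoeffTorus_eq_integral, fourierCoeffTorus_eq_integral, ← integral_const_mul]
  congr 1; ext t
  simp [mul_left_comm]

/-- The `k`-th Fourier coefficient as a bounded linear functional on `C(𝕋²)`. -/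
noncomputable def fourierCoeffCLM (k : ℤ × ℤ) : C(Torus2, ℂ) →L[ℂ] ℂ :=
  LinearMap.mkContinuous
    { toFun := fun f => fourierCoeffTorus f k.1 k.2
      map_add' := fun f g => fourierCoeffTorus_add f g _ _
      map_smul' := fun a f => fourierCoeffTorus_smul a f k } 1
    fun f => by simpa using norm_fourierCoeffTorus_le f k

theorem fourierCoeffCLM_apply (k : ℤ × ℤ) (f : C(Torus2, ℂ)) :
    fourierCoeffCLM k f = fourierCoeffTorus f k.1 k.2 := rfl

/-- Translation of a function on the torus: `x ↦ f (c * x)`. -/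
noncomputable def torusTranslate (c : Torus2) (f : C(Torus2, ℂ)) : C(Torus2, ℂ) :=
  f.comp ⟨fun x => c * x, by fun_prop⟩

theorem torusTranslate_apply (c x : Torus2) (f : C(Torus2, ℂ)) : torusTranslate c f x = f (c * x) := rfl

theorem torusTranslate_torusChar (c : Torus2) (k : ℤ × ℤ) :
    torusTranslate c (torusChar k) = torusChar k c • torusChar k := by
  ext x; simp [torusTranslate_apply, torusChar_apply_mul]

theorem fourierCoeffTorus_torusTranslate (c : Torus2) (f : C(Torus2, ℂ)) (k : ℤ × ℤ) :
    fourierCoeffTorus (torusTranslate c f) k.1 k.2 = torusChar k c * fourierCoeffTorus f k.1 k.2 := by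
  obtain ⟨s, rfl⟩ := torusParam_surjective c
  rw [fourierCoeffTorus_eq_integral, fourierCoeffTorus_eq_integral, ← integral_const_mul,
    ← integral_add_left_eq_self _ s]
  rw [← integral_add_left_eq_self (fun t => torusChar k (torusParam s) *
    (torusChar (-k) (torusParam t) * f (torusParam t))) s,
    integral_add_left_eq_self (fun t => torusChar (-k) (torusParam t) *
      torusTranslate (torusParam s) f (torusParam t)) s]
  congr 1; ext t
  have h : torusChar k (torusParam s) * torusChar (-k) (torusParam s) = 1 := by
    rw [← ContinuousMap.mul_apply, ← torusChar_add, add_neg_cancel, torusChar_zero]; rfl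
  rw [torusTranslate_apply, torusParam_add, torusChar_apply_mul]
  linear_combination (-torusChar (-k) (torusParam t) * f (torusParam s * torusParam t)) * h

theorem fourierCoeffTorus_torusChar_self (k : ℤ × ℤ) :
    fourierCoeffTorus (torusChar k) k.1 k.2 = 1 := by
  rw [fourierCoeffTorus_eq_integral]
  have h : ∀ t, torusChar (-k) (torusParam t) * torusChar k (torusParam t) = 1 := fun t => by
    rw [← ContinuousMap.mul_apply, ← torusChar_add, neg_add_cancel, torusChar_zero]; rfl
  simp [h]

theorem exists_torusChar_ne_one {k : ℤ × ℤ} (hk : k ≠ 0) : ∃ c, torusChar k c ≠ 1 := by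
  by_contra! h
  have h1 : torusChar k = algebraMap ℂ _ 1 := by ext x; simp [h]
  have h2 := fourierCoeffTorus_torusChar_self k
  rw [h1, fourierCoeffTorus_algebraMap] at h2
  · exact zero_ne_one h2
  · by_contra! h0
    exact hk (Prod.ext h0.1 h0.2)

theorem fourierCoeffTorus_torusChar_of_ne {k l : ℤ × ℤ} (h : k ≠ l) :
    fourierCoeffTorus (torusChar k) l.1 l.2 = 0 := by
  obtain ⟨c, hc⟩ := exists_torusChar_ne_one (sub_ne_zero.2 h.symm)
  have h1 := fourierCoeffTorus_torusTranslate c (torusChar k) l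
  rw [torusTranslate_torusChar, fourierCoeffTorus_smul] at h1
  by_contra h0
  have h2 := mul_right_cancel₀ h0 h1
  refine hc ?_
  have h3 : torusChar l c = torusChar (l - k) c * torusChar k c := by
    rw [← ContinuousMap.mul_apply, ← torusChar_add, sub_add_cancel]
  have h4 : torusChar k c ≠ 0 := norm_ne_zero_iff.1 (by simp [norm_torusChar_apply])
  exact mul_right_cancel₀ h4 (by rw [← h3, one_mul, h2])

/-- Convolution with a character: the `C(𝕋²)`-valued integral of the translates of `f` against
`χ₋ₖ` is `f̂(k) χₖ`. -/
theorem integral_torusChar_smul_torusTranslate (f : C(Torus2, ℂ)) (k : ℤ × ℤ)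
    (hc : Continuous fun t => torusTranslate (torusParam t) f) :
    ∫ t, torusChar (-k) (torusParam t) • torusTranslate (torusParam t) f ∂paramHaar =
      fourierCoeffTorus f k.1 k.2 • torusChar k := by
  ext x
  rw [ContinuousMap.integral_apply]
  · rw [ContinuousMap.smul_apply, smul_eq_mul, mul_comm, ← fourierCoeffTorus_torusTranslate,
      fourierCoeffTorus_eq_integral]
    congr 1; ext t
    simp [torusTranslate_apply, mul_comm x]
  · exact integrable_comp_torusParam (by fun_prop)

theorem continuous_torusTranslate (f : C(Torus2, ℂ)) : Continuous fun c => torusTranslate c f := by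
  have h : Continuous fun p : Torus2 × Torus2 => f (p.1 * p.2) := by fun_prop
  exact (ContinuousMap.curry ⟨_, h⟩).continuous

/-- Fejér's theorem, qualitatively: a continuous function on the torus is a uniform limit of
linear combinations of the characters in its spectrum. The convolutions of `f` with trigonometric
polynomials lie in the span of these characters, hence so do, up to closure, its convolutions with
all continuous functions, and these include an approximate identity. -/
theorem mem_closure_span_torusChar (f : C(Torus2, ℂ)) :
    f ∈ (Submodule.span ℂ
      (torusChar '' {k | fourierCoeffTorus f k.1 k.2 ≠ 0})).topologicalClosure := by
  set S := (Submodule.span ℂ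
    (torusChar '' {k | fourierCoeffTorus f k.1 k.2 ≠ 0})).topologicalClosure
  have hSc : IsClosed (S : Set C(Torus2, ℂ)) := Submodule.isClosed_topologicalClosure _
  let τ : C(UnitAddTorus (Fin 2), C(Torus2, ℂ)) :=
    ⟨fun t => torusTranslate (torusParam t) f, (continuous_torusTranslate f).comp torusParam.continuous⟩
  have hint : ∀ P : C(UnitAddTorus (Fin 2), ℂ), Integrable (fun t => P t • τ t) paramHaar :=
    fun P => integrable_comp_torusParam (by fun_prop)
  let J : C(UnitAddTorus (Fin 2), ℂ) →ₗ[ℂ] C(Torus2, ℂ) :=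
    { toFun := fun P => ∫ t, P t • τ t ∂paramHaar
      map_add' := fun P Q => by
        rw [← integral_add (hint P) (hint Q)]
        simp only [ContinuousMap.add_apply, add_smul]
      map_smul' := fun a P => by
        rw [RingHom.id_apply, ← integral_smul]
        simp only [ContinuousMap.smul_apply, smul_assoc] }
  have hJ : Continuous J := by
    refine (LinearMap.mkContinuous J ‖τ‖ fun P => ?_).continuous
    refine (norm_integral_le_of_norm_le_const (C := ‖τ‖ * ‖P‖) (ae_of_all _ fun t => ?_)).trans ?_
    · rw [norm_smul, mul_comm]
      exact mul_le_mul (τ.norm_coe_le_norm t) (P.norm_coe_le_norm t) (norm_nonneg _)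
        (norm_nonneg _)
    · simp
  have hJS : ∀ P, J P ∈ S := by
    intro P
    have hP : P ∈ (Submodule.span ℂ
        (Set.range (UnitAddTorus.mFourier (d := Fin 2)))).topologicalClosure := by
      rw [UnitAddTorus.span_mFourier_closure_eq_top]; trivial
    have hle : (Submodule.span ℂ
        (Set.range (UnitAddTorus.mFourier (d := Fin 2)))).topologicalClosure ≤ S.comap J := by
      refine Submodule.topologicalClosure_minimal _ (Submodule.span_le.2 ?_) (hSc.preimage hJ)
      rintro _ ⟨n, rfl⟩
      have hn : J (UnitAddTorus.mFourier n) =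
          fourierCoeffTorus f (-n 0) (-n 1) • torusChar (-n 0, -n 1) := by
        rw [← integral_torusChar_smul_torusTranslate f (-n 0, -n 1) τ.continuous]
        refine integral_congr_ae (ae_of_all _ fun t => ?_)
        have hn2 : ![n 0, n 1] = n := by ext i; fin_cases i <;> rfl
        simp [torusChar_torusParam, hn2, τ]
      change J (UnitAddTorus.mFourier n) ∈ S
      rw [hn]
      by_cases h0 : fourierCoeffTorus f (-n 0) (-n 1) = 0
      · rw [h0, zero_smul]; exact S.zero_mem
      · exact S.smul_mem _ (Submodule.le_topologicalClosure _
          (Submodule.subset_span ⟨(-n 0, -n 1), h0, rfl⟩))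
    exact hle hP
  have key := tendsto_setIntegral_pow_smul_of_unique_maximum_of_isCompact_of_measure_nhdsWithin_pos
    (μ := paramHaar) (s := Set.univ) (x₀ := (0 : UnitAddTorus (Fin 2)))
    (c := fun t => (1 + ‖t‖)⁻¹) (g := τ) isCompact_univ
    (fun u hu h0 => by rw [Set.inter_univ]; exact hu.measure_pos _ ⟨0, h0⟩)
    (Continuous.continuousOn (Continuous.inv₀ (by fun_prop) fun t => by positivity))
    (fun y _ hy => by
      have := norm_pos_iff.2 hy
      simp only [norm_zero, add_zero, inv_one]
      exact inv_lt_one_of_one_lt₀ (by linarith))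
    (fun t _ => by positivity) (by simp) (Set.mem_univ _)
    (τ.continuous.continuousOn.integrableOn_compact isCompact_univ)
    τ.continuous.continuousWithinAt
  have hτ0 : τ 0 = f := by
    ext x; simp [τ, torusTranslate_apply, torusParam_zero]
  rw [hτ0] at key
  refine hSc.mem_of_tendsto key (Eventually.of_forall fun n => ?_)
  rw [Measure.restrict_univ]
  have hcn : Continuous fun t : UnitAddTorus (Fin 2) => (((1 + ‖t‖)⁻¹ ^ n : ℝ) : ℂ) :=
    Complex.continuous_ofReal.comp
      ((Continuous.inv₀ (by fun_prop) fun t => by positivity).pow n)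
  have h1 := S.smul_of_tower_mem (∫ t, ((1 + ‖t‖)⁻¹ ^ n : ℝ) ∂paramHaar)⁻¹ (hJS ⟨_, hcn⟩)
  have h2 : J ⟨_, hcn⟩ = ∫ t, ((1 + ‖t‖)⁻¹ ^ n : ℝ) • τ t ∂paramHaar :=
    integral_congr_ae (ae_of_all _ fun t => Complex.coe_smul _ _)
  rwa [h2] at h1

/-- A function whose spectrum contains at most one point is a multiple of a character. -/
theorem eq_smul_torusChar_of_spectrum (f : C(Torus2, ℂ)) (k : ℤ × ℤ)
    (h : ∀ l, l ≠ k → fourierCoeffTorus f l.1 l.2 = 0) : ∃ a : ℂ, f = a • torusChar k := by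
  have h1 : (Submodule.span ℂ
      (torusChar '' {k | fourierCoeffTorus f k.1 k.2 ≠ 0})).topologicalClosure ≤
      Submodule.span ℂ {torusChar k} := by
    refine Submodule.topologicalClosure_minimal _ (Submodule.span_mono ?_)
      (Submodule.closed_of_finiteDimensional _)
    rintro _ ⟨l, hl, rfl⟩
    by_contra h0
    exact hl (h l fun e => h0 (by rw [e]; rfl))
  obtain ⟨a, ha⟩ := Submodule.mem_span_singleton.1 (h1 (mem_closure_span_torusChar f))
  exact ⟨a, ha.symm⟩

/-! ### The order on the dual group and the flow -/

/-- The embedding `(m, n) ↦ m + α n` of the dual group `ℤ²` of the torus into `ℝ`. -/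
noncomputable def weight (α : ℝ) : ℤ × ℤ →+ ℝ where
  toFun k := k.1 + α * k.2
  map_zero' := by simp
  map_add' k l := by push_cast [Prod.fst_add, Prod.snd_add]; ring

theorem weight_apply (α : ℝ) (k : ℤ × ℤ) : weight α k = k.1 + α * k.2 := rfl

theorem weight_injective {α : ℝ} (hirr : Irrational α) : Function.Injective (weight α) := by
  refine (injective_iff_map_eq_zero _).2 fun k hk => ?_
  rw [weight_apply] at hk
  have h2 : k.2 = 0 := by
    by_contra h
    have h' : (k.2 : ℝ) ≠ 0 := by exact_mod_cast h
    exact (irrational_iff_ne_rational α).1 hirr (-k.1) k.2 h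
      (by rw [eq_div_iff h']; push_cast; linarith)
  rw [h2] at hk
  simp only [Int.cast_zero, mul_zero, add_zero, Int.cast_eq_zero] at hk
  exact Prod.ext hk h2

/-- The weights are dense in `ℝ`; in particular there are arbitrarily small positive ones. -/
theorem exists_weight_mem_Ioo {α : ℝ} (hirr : Irrational α) {ε : ℝ} (hε : 0 < ε) :
    ∃ k, 0 < weight α k ∧ weight α k < ε := by
  have h : Dense ((weight α).range : Set ℝ) := by
    refine ((weight α).range.dense_or_cyclic).resolve_right ?_
    rintro ⟨a, ha⟩
    have h1 : weight α (1, 0) ∈ AddSubgroup.closure {a} := ha ▸ ⟨_, rfl⟩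
    have h2 : weight α (0, 1) ∈ AddSubgroup.closure {a} := ha ▸ ⟨_, rfl⟩
    obtain ⟨m, hm⟩ := AddSubgroup.mem_closure_singleton.1 h1
    obtain ⟨n, hn⟩ := AddSubgroup.mem_closure_singleton.1 h2
    have h3 : n • (1, 0) = m • ((0, 1) : ℤ × ℤ) := by
      apply weight_injective hirr
      rw [map_zsmul, map_zsmul, ← hm, ← hn, smul_comm]
    have h4 : m = 0 := by simpa using (congrArg Prod.snd h3).symm
    rw [h4, zero_smul, weight_apply] at hm
    simp at hm
  obtain ⟨_, ⟨k, rfl⟩, h1, h2⟩ := h.exists_between hε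
  exact ⟨k, h1, h2⟩

/-- The one-parameter subgroup `t ↦ (e^{it}, e^{iαt})` of the torus. -/
noncomputable def flow (α t : ℝ) : Torus2 := (Circle.exp t, Circle.exp (α * t))

theorem torusChar_flow (α t : ℝ) (k : ℤ × ℤ) :
    torusChar k (flow α t) = Complex.exp (weight α k * t * Complex.I) := by
  simp only [torusChar_apply, flow, Circle.coe_mul, Circle.coe_zpow, Circle.coe_exp,
    ← Complex.exp_int_mul, ← Complex.exp_add, weight_apply]
  congr 1; push_cast; ring

theorem flow_zero (α : ℝ) : flow α 0 = 1 := by simp [flow]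

theorem flow_add (α s t : ℝ) : flow α (s + t) = flow α s * flow α t := by
  simp [flow, mul_add, Circle.exp_add]

/-- The spectrum of a continuous eigenfunction of the flow has only points of weight equal to the
eigenvalue. -/
theorem weight_eq_of_flow_eigenfunction {α ω : ℝ} {f : C(Torus2, ℂ)}
    (h : ∀ t x, f (flow α t * x) = Complex.exp (ω * t * Complex.I) * f x) {k : ℤ × ℤ}
    (hk : fourierCoeffTorus f k.1 k.2 ≠ 0) : weight α k = ω := by
  by_contra hne
  have h1 : ∀ t : ℝ, Complex.exp (weight α k * t * Complex.I) =
      Complex.exp (ω * t * Complex.I) := fun t => by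
    have h2 : torusTranslate (flow α t) f = Complex.exp (ω * t * Complex.I) • f := by
      ext x; simp [torusTranslate_apply, h]
    have h3 := fourierCoeffTorus_torusTranslate (flow α t) f k
    rw [h2, fourierCoeffTorus_smul, torusChar_flow] at h3
    exact (mul_right_cancel₀ hk h3).symm
  have h4 : (weight α k - ω : ℝ) ≠ 0 := sub_ne_zero.2 hne
  have h5 := h1 (Real.pi / (weight α k - ω))
  rw [← mul_inv_eq_one₀ (Complex.exp_ne_zero _), ← Complex.exp_neg, ← Complex.exp_add] at h5
  have h6 : (weight α k * ((Real.pi / (weight α k - ω) : ℝ) : ℂ) * Complex.I +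
      -(ω * ((Real.pi / (weight α k - ω) : ℝ) : ℂ) * Complex.I)) = Real.pi * Complex.I := by
    have h7 : (weight α k - ω : ℂ) ≠ 0 := by exact_mod_cast h4
    push_cast
    field_simp
    ring
  rw [h6, Complex.exp_pi_mul_I] at h5
  norm_num at h5

/-- A nonzero continuous eigenfunction of the flow is a multiple of a character. -/
theorem exists_eq_smul_torusChar_of_flow_eigenfunction {α ω : ℝ} (hirr : Irrational α)
    {f : C(Torus2, ℂ)} (hf : f ≠ 0)
    (h : ∀ t x, f (flow α t * x) = Complex.exp (ω * t * Complex.I) * f x) :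
    ∃ k, weight α k = ω ∧ ∃ a : ℂ, f = a • torusChar k := by
  have h1 : ∃ k : ℤ × ℤ, fourierCoeffTorus f k.1 k.2 ≠ 0 := by
    by_contra! h0
    obtain ⟨a, ha⟩ := eq_smul_torusChar_of_spectrum f 0 fun l _ => h0 l
    have h2 := h0 0
    rw [ha, fourierCoeffTorus_smul, fourierCoeffTorus_torusChar_self, mul_one] at h2
    exact hf (by rw [ha, h2, zero_smul])
  obtain ⟨k, hk⟩ := h1
  have hkω := weight_eq_of_flow_eigenfunction h hk
  refine ⟨k, hkω, eq_smul_torusChar_of_spectrum f k fun l hl => ?_⟩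
  by_contra h0
  exact hl (weight_injective hirr ((weight_eq_of_flow_eigenfunction h h0).trans hkω.symm))

/-! ### Rigidity of inner functions with roots in the half-plane -/

theorem sq_norm_one_sub_conj_mul (a b : ℂ) :
    ‖1 - conj b * a‖ ^ 2 = ‖a - b‖ ^ 2 + (1 - ‖a‖ ^ 2) * (1 - ‖b‖ ^ 2) := by
  simp only [Complex.sq_norm, Complex.normSq_apply]
  simp
  ring

theorem sq_norm_add_conj (z w : ℂ) : ‖z + conj w‖ ^ 2 = ‖z - w‖ ^ 2 + 4 * (z.re * w.re) := by
  simp only [Complex.sq_norm, Complex.normSq_apply]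
  simp
  ring

theorem norm_sub_lt_norm_add_conj {z w : ℂ} (hz : 0 < z.re) (hw : 0 < w.re) :
    ‖z - w‖ < ‖z + conj w‖ := by
  have h := sq_norm_add_conj z w
  have h1 := mul_pos hz hw
  exact lt_of_pow_lt_pow_left₀ 2 (norm_nonneg _) (by linarith)

theorem norm_sub_lt_norm_one_sub_conj_mul {a b : ℂ} (ha : ‖a‖ < 1) (hb : ‖b‖ < 1) :
    ‖a - b‖ < ‖1 - conj b * a‖ := by
  have h := sq_norm_one_sub_conj_mul a b
  have h1 : 0 < (1 - ‖a‖ ^ 2) * (1 - ‖b‖ ^ 2) :=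
    mul_pos (by nlinarith [norm_nonneg a]) (by nlinarith [norm_nonneg b])
  exact lt_of_pow_lt_pow_left₀ 2 (norm_nonneg _) (by linarith)

theorem schwarzPick_halfPlane_of_lt {F : ℂ → ℂ} (hd : DifferentiableOn ℂ F {z | 0 < z.re})
    (hF : ∀ z : ℂ, 0 < z.re → ‖F z‖ < 1) {z w : ℂ} (hz : 0 < z.re) (hw : 0 < w.re) :
    ‖F z - F w‖ * ‖z + conj w‖ ≤ ‖z - w‖ * ‖1 - conj (F w) * F z‖ := by
  have hφ1 : ∀ ζ ∈ Metric.ball (0 : ℂ) 1, 1 - ζ ≠ 0 := fun ζ hζ h => by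
    rw [← sub_eq_zero.1 h] at hζ
    simp at hζ
  set φ : ℂ → ℂ := fun ζ => (w + conj w * ζ) / (1 - ζ) with hφ
  have hφH : ∀ ζ ∈ Metric.ball (0 : ℂ) 1, 0 < (φ ζ).re := fun ζ hζ => by
    have h1 : (φ ζ).re = w.re * (1 - ‖ζ‖ ^ 2) / Complex.normSq (1 - ζ) := by
      simp only [hφ, Complex.div_re, Complex.sq_norm]
      rw [← add_div]
      congr 1
      simp [Complex.normSq_apply]
      ring
    rw [h1]
    have h2 : ‖ζ‖ < 1 := by simpa using hζ
    exact div_pos (mul_pos hw (by nlinarith [norm_nonneg ζ])) (Complex.normSq_pos.2 (hφ1 ζ hζ))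
  have hden : ∀ ζ ∈ Metric.ball (0 : ℂ) 1, 1 - conj (F w) * F (φ ζ) ≠ 0 := fun ζ hζ h => by
    have h1 := norm_sub_lt_norm_one_sub_conj_mul (hF _ (hφH ζ hζ)) (hF _ hw)
    rw [h, norm_zero] at h1
    exact absurd h1 (norm_nonneg _).not_gt
  have hφd : DifferentiableOn ℂ φ (Metric.ball 0 1) :=
    DifferentiableOn.div (by fun_prop) (by fun_prop) hφ1
  have hFφ : DifferentiableOn ℂ (fun ζ => F (φ ζ)) (Metric.ball 0 1) := hd.comp hφd hφH
  set G : ℂ → ℂ := fun ζ => (F (φ ζ) - F w) / (1 - conj (F w) * F (φ ζ)) with hG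
  have hGd : DifferentiableOn ℂ G (Metric.ball 0 1) :=
    DifferentiableOn.div (hFφ.sub_const _) ((hFφ.const_mul _).const_sub _) hden
  have hGm : Set.MapsTo G (Metric.ball 0 1) (Metric.ball 0 1) := fun ζ hζ => by
    have h1 := norm_sub_lt_norm_one_sub_conj_mul (hF _ (hφH ζ hζ)) (hF _ hw)
    rw [mem_ball_zero_iff, hG, norm_div, div_lt_one ((norm_nonneg _).trans_lt h1)]
    exact h1
  have hφ0 : φ 0 = w := by simp [hφ]
  have hG0 : G 0 = 0 := by simp only [hG, hφ0, sub_self, zero_div]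
  have hP := norm_sub_lt_norm_add_conj hz hw
  have hP0 : 0 < ‖z + conj w‖ := (norm_nonneg _).trans_lt hP
  have hne : z + conj w ≠ 0 := norm_pos_iff.1 hP0
  have hww : w + conj w ≠ 0 := fun h => by
    have := congrArg Complex.re h
    simp at this
    linarith
  have hζ : ‖(z - w) / (z + conj w)‖ < 1 := by rwa [norm_div, div_lt_one hP0]
  have hφz : φ ((z - w) / (z + conj w)) = z := by
    have h1 : 1 - (z - w) / (z + conj w) = (w + conj w) / (z + conj w) := by
      field_simp; ring
    simp only [hφ, h1]
    field_simp
    ring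
  have key := Complex.norm_le_norm_of_mapsTo_ball hGd
    (fun ζ h => by simpa using (mem_ball_zero_iff.1 (hGm h)).le) hG0 hζ
  have h2 := norm_sub_lt_norm_one_sub_conj_mul (hF _ hz) (hF _ hw)
  rw [hG] at key
  simp only [hφz] at key
  rwa [norm_div, norm_div, div_le_div_iff₀ ((norm_nonneg _).trans_lt h2) hP0] at key

/-- The Schwarz–Pick lemma for the right half-plane, in terms of the moduli. -/
theorem schwarzPick_halfPlane {F : ℂ → ℂ} (hd : DifferentiableOn ℂ F {z | 0 < z.re})
    (hF : ∀ z : ℂ, 0 < z.re → ‖F z‖ ≤ 1) {z w : ℂ} (hz : 0 < z.re) (hw : 0 < w.re) :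
    (‖F w‖ - ‖F z‖) * ‖z + conj w‖ ≤ ‖z - w‖ * (1 - ‖F w‖ * ‖F z‖) := by
  -- The strict inequality `‖F‖ < 1` is arranged by a factor `r < 1`, which then tends to `1`.
  have hr : ∀ r : ℝ, r ∈ Set.Ioo (0 : ℝ) 1 →
      (r * ‖F w‖ - r * ‖F z‖) * ‖z + conj w‖ ≤
        ‖z - w‖ * (1 - (r * ‖F w‖) * (r * ‖F z‖)) := by
    rintro r ⟨hr0, hr1⟩
    have hlt : ∀ z : ℂ, 0 < z.re → ‖(r : ℂ) * F z‖ < 1 := fun z hz => by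
      rw [norm_mul, Complex.norm_real, Real.norm_of_nonneg hr0.le]
      nlinarith [hF z hz, norm_nonneg (F z)]
    have h := schwarzPick_halfPlane_of_lt (F := fun z => (r : ℂ) * F z) (hd.const_mul _) hlt hz hw
    have hn : ∀ z, r * ‖F z‖ = ‖(r : ℂ) * F z‖ := fun z => by
      rw [norm_mul, Complex.norm_real, Real.norm_of_nonneg hr0.le]
    rw [hn, hn]
    have ha := hlt z hz
    have hb := hlt w hw
    generalize (r : ℂ) * F z = a at *
    generalize (r : ℂ) * F w = b at *
    have hPQ := norm_sub_lt_norm_add_conj hz hw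
    have h1 := sq_norm_one_sub_conj_mul a b
    have hab : ‖a‖ * ‖b‖ ≤ 1 := mul_le_one₀ ha.le (norm_nonneg _) hb.le
    refine (abs_le_of_sq_le_sq' ?_ (mul_nonneg (norm_nonneg _) (by linarith [mul_comm ‖a‖ ‖b‖]))).2
    have h2 : (‖b‖ - ‖a‖) ^ 2 ≤ ‖a - b‖ ^ 2 := by
      rw [← sq_abs, abs_sub_comm]
      gcongr
      exact abs_norm_sub_norm_le a b
    have h3 := pow_le_pow_left₀ (by positivity) h 2
    rw [mul_pow, mul_pow, h1] at h3
    have h4 : 0 ≤ ‖z + conj w‖ ^ 2 - ‖z - w‖ ^ 2 := by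
      have := pow_le_pow_left₀ (norm_nonneg _) hPQ.le 2
      linarith
    have h5 := mul_le_mul_of_nonneg_right h2 h4
    rw [mul_pow, mul_pow]
    nlinarith
  have hcont : Continuous fun r : ℝ => ‖z - w‖ * (1 - (r * ‖F w‖) * (r * ‖F z‖)) -
      (r * ‖F w‖ - r * ‖F z‖) * ‖z + conj w‖ := by fun_prop
  have hlim := (hcont.tendsto 1).mono_left (nhdsWithin_le_nhds (s := Set.Iio 1))
  have := ge_of_tendsto (b := 0) hlim (by
    filter_upwards [Ioo_mem_nhdsLT (zero_lt_one' ℝ)] with r h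
    linarith [hr r h])
  simp only [one_mul] at this
  linarith

/-- A nonnegative function on the positive cone of a group with a homomorphism to `ℝ` which is
additive there is proportional to the homomorphism. -/
theorem exists_eq_mul_of_additive {K : Type*} [AddCommGroup K] (wt : K →+ ℝ)
    (hpos : ∃ h, 0 < wt h) (l : K → ℝ) (hl : ∀ k, 0 ≤ wt k → 0 ≤ l k)
    (hadd : ∀ k k', 0 ≤ wt k → 0 ≤ wt k' → l (k + k') = l k + l k') :
    ∃ c : ℝ, 0 ≤ c ∧ ∀ k, 0 ≤ wt k → l k = wt k * c := by
  have hl0 : l 0 = 0 := by simpa using hadd 0 0 (by simp) (by simp)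
  have hmul : ∀ (n : ℕ) k, 0 ≤ wt k → l (n • k) = n * l k := by
    intro n k hk
    induction n with
    | zero => simp [hl0]
    | succ n ih =>
      rw [succ_nsmul, hadd _ _ (by rw [map_nsmul]; exact nsmul_nonneg hk n) hk, ih]
      push_cast; ring
  have hmono : ∀ k k', 0 ≤ wt k → wt k ≤ wt k' → l k ≤ l k' := fun k k' hk hkk' => by
    have h1 : 0 ≤ wt (k' - k) := by rw [map_sub]; linarith
    have h2 := hadd _ _ hk h1
    rw [add_sub_cancel] at h2
    linarith [hl _ h1]
  have hle : ∀ k h, 0 ≤ wt k → 0 < wt h → l k * wt h ≤ l h * wt k := by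
    intro k h hk hh
    by_contra! hlt
    obtain ⟨n, hn⟩ := exists_nat_gt (l h * wt h / (l k * wt h - l h * wt k))
    rw [div_lt_iff₀ (by linarith)] at hn
    have hm := Nat.ceil_lt_add_one (a := n * wt k / wt h) (by positivity)
    have hm' := Nat.le_ceil (n * wt k / wt h)
    set m := ⌈n * wt k / wt h⌉₊
    rw [div_le_iff₀ hh] at hm'
    have hm2 : m * wt h < n * wt k + wt h := by
      have := mul_lt_mul_of_pos_right hm hh
      rwa [add_mul, div_mul_cancel₀ _ hh.ne', one_mul] at this
    have h1 := hmono (n • k) (m • h) (by rw [map_nsmul]; exact nsmul_nonneg hk n)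
      (by simpa [map_nsmul] using hm')
    rw [hmul _ _ hk, hmul _ _ hh.le] at h1
    have h2 := mul_le_mul_of_nonneg_right h1 hh.le
    have h3 := mul_le_mul_of_nonneg_left hm2.le (hl h hh.le)
    nlinarith
  obtain ⟨h, hh⟩ := hpos
  refine ⟨l h / wt h, div_nonneg (hl h hh.le) hh.le, fun k hk => ?_⟩
  rw [mul_div_assoc', eq_div_iff hh.ne', mul_comm (wt k)]
  refine le_antisymm (hle k h hk hh) ?_
  rcases hk.eq_or_lt with h0 | h0
  · rw [← h0, mul_zero]
    exact mul_nonneg (hl k hk) hh.le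
  · exact hle h k hh.le h0

/-- A semigroup of inner functions: a family of functions `F k`, continuous on the closed and
holomorphic on the open right half-plane, bounded by `1` and unimodular on the imaginary axis,
which is multiplicative in `k`, where `k` ranges over the elements of nonnegative weight. -/
structure InnerFamily {K : Type*} [AddCommGroup K] (wt : K →+ ℝ) (F : K → ℂ → ℂ) : Prop where
  map_zero : ∀ z : ℂ, 0 ≤ z.re → F 0 z = 1
  map_add : ∀ k l, 0 ≤ wt k → 0 ≤ wt l → ∀ z : ℂ, 0 ≤ z.re → F (k + l) z = F k z * F l z
  continuousOn : ∀ k, 0 ≤ wt k → ContinuousOn (F k) {z | 0 ≤ z.re}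
  differentiableOn : ∀ k, 0 ≤ wt k → DifferentiableOn ℂ (F k) {z | 0 < z.re}
  norm_le : ∀ k, 0 ≤ wt k → ∀ z : ℂ, 0 ≤ z.re → ‖F k z‖ ≤ 1
  norm_boundary : ∀ k, 0 ≤ wt k → ∀ z : ℂ, z.re = 0 → ‖F k z‖ = 1

namespace InnerFamily

variable {K : Type*} [AddCommGroup K] {wt : K →+ ℝ} {F : K → ℂ → ℂ}

theorem map_nsmul (hF : InnerFamily wt F) (n : ℕ) {k : K} (hk : 0 ≤ wt k) {z : ℂ}
    (hz : 0 ≤ z.re) : F (n • k) z = F k z ^ n := by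
  induction n with
  | zero => rw [zero_smul, pow_zero, hF.map_zero z hz]
  | succ n ih =>
    rw [succ_nsmul, hF.map_add _ _ (by rw [_root_.map_nsmul]; exact nsmul_nonneg hk n) hk z hz, ih,
      pow_succ]

theorem norm_le_of_wt_le (hF : InnerFamily wt F) {k l : K} (hk : 0 ≤ wt k) (hkl : wt k ≤ wt l)
    {z : ℂ} (hz : 0 ≤ z.re) : ‖F l z‖ ≤ ‖F k z‖ := by
  have h1 : 0 ≤ wt (l - k) := by rw [map_sub]; linarith
  have h2 := hF.map_add _ _ hk h1 z hz
  rw [add_sub_cancel] at h2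
  rw [h2, norm_mul]
  exact mul_le_of_le_one_right (norm_nonneg _) (hF.norm_le _ h1 z hz)

/-- Since arbitrarily small weights occur, the members of an inner family have no zeros: a common
zero `z₀` would make all of them divisible by arbitrarily high powers of functions which, by the
Schwarz lemma, are bounded away from `1` at each given point. -/
theorem ne_zero (hF : InnerFamily wt F) (hsmall : ∀ ε : ℝ, 0 < ε → ∃ h, 0 < wt h ∧ wt h < ε)
    {k : K} (hk : 0 ≤ wt k) {z₀ : ℂ} (hz₀ : 0 < z₀.re) : F k z₀ ≠ 0 := by
  intro h0
  have hall : ∀ h, 0 < wt h → F h z₀ = 0 := by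
    intro h hh
    obtain ⟨n, hn⟩ := exists_nat_gt (wt k / wt h)
    rw [div_lt_iff₀ hh] at hn
    have h1 := hF.norm_le_of_wt_le hk (l := n • h) (by simpa using hn.le) hz₀.le
    rw [h0, norm_zero, hF.map_nsmul n hh.le hz₀.le] at h1
    exact eq_zero_of_pow_eq_zero (norm_le_zero_iff.1 h1)
  obtain ⟨g, hg, -⟩ := hsmall 1 one_pos
  have hzero : ∀ z : ℂ, 0 < z.re → F g z = 0 := by
    intro z hz
    have hlt := norm_sub_lt_norm_add_conj hz₀ hz
    have hP : 0 < ‖z₀ + conj z‖ := (norm_nonneg _).trans_lt hlt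
    have hρ : ‖z₀ - z‖ / ‖z₀ + conj z‖ < 1 := (div_lt_one hP).2 hlt
    have hbound : ∀ n : ℕ, ‖F g z‖ ≤ (‖z₀ - z‖ / ‖z₀ + conj z‖) ^ n := by
      intro n
      obtain ⟨h, hh, hhn⟩ := hsmall (wt g / (n + 1)) (by positivity)
      rw [lt_div_iff₀ (by positivity)] at hhn
      have h1 := schwarzPick_halfPlane (hF.differentiableOn h hh.le)
        (fun z hz => hF.norm_le h hh.le z hz.le) hz₀ hz
      rw [hall h hh, norm_zero, sub_zero, mul_zero, sub_zero, mul_one, ← le_div_iff₀ hP] at h1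
      have h2 := hF.norm_le_of_wt_le (k := n • h) (l := g)
        (by rw [_root_.map_nsmul]; exact nsmul_nonneg hh.le n)
        (by rw [_root_.map_nsmul, nsmul_eq_mul]; nlinarith) hz.le
      rw [hF.map_nsmul n hh.le hz.le, norm_pow] at h2
      exact h2.trans (pow_le_pow_left₀ (norm_nonneg _) h1 n)
    have h3 := ge_of_tendsto' (tendsto_pow_atTop_nhds_zero_of_lt_one (by positivity) hρ) hbound
    exact norm_le_zero_iff.1 h3
  have hb := hF.norm_boundary g hg.le 0 rfl
  have hc := hF.continuousOn g hg.le 0 (by simp)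
  have hs : Tendsto (fun s : ℝ => (s : ℂ)) (𝓝[>] 0) (𝓝[{z | 0 ≤ z.re}] 0) := by
    refine tendsto_nhdsWithin_iff.2 ⟨?_, ?_⟩
    · exact (Complex.continuous_ofReal.tendsto' 0 0 (by simp)).mono_left nhdsWithin_le_nhds
    · filter_upwards [self_mem_nhdsWithin] with s hs
      simpa using (Set.mem_Ioi.1 hs).le
  have hlim := hc.tendsto.comp hs
  have hlim0 : Tendsto (F g ∘ fun s : ℝ => (s : ℂ)) (𝓝[>] 0) (𝓝 0) := by
    refine tendsto_const_nhds.congr' ?_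
    filter_upwards [self_mem_nhdsWithin] with s hs
    exact (hzero s (by simpa using hs)).symm
  rw [tendsto_nhds_unique hlim hlim0, norm_zero] at hb
  exact zero_ne_one hb

theorem ne_zero' (hF : InnerFamily wt F) (hsmall : ∀ ε : ℝ, 0 < ε → ∃ h, 0 < wt h ∧ wt h < ε)
    {k : K} (hk : 0 ≤ wt k) {z : ℂ} (hz : 0 ≤ z.re) : F k z ≠ 0 := by
  rcases hz.eq_or_lt with h | h
  · exact norm_ne_zero_iff.1 (by rw [hF.norm_boundary k hk z h.symm]; exact one_ne_zero)
  · exact hF.ne_zero hsmall hk h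

/-- The decay rate of an inner family at each point of the half-plane: `-log ‖F k z‖` is
proportional to the weight of `k`. -/
theorem exists_rate (hF : InnerFamily wt F) (hsmall : ∀ ε : ℝ, 0 < ε → ∃ h, 0 < wt h ∧ wt h < ε)
    {z : ℂ} (hz : 0 ≤ z.re) :
    ∃ c : ℝ, 0 ≤ c ∧ ∀ k, 0 ≤ wt k → ‖F k z‖ = Real.exp (-(wt k * c)) := by
  obtain ⟨h, hh, -⟩ := hsmall 1 one_pos
  have hpos : ∀ k, 0 ≤ wt k → 0 < ‖F k z‖ := fun k hk => norm_pos_iff.2 (hF.ne_zero' hsmall hk hz)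
  obtain ⟨c, hc0, hc⟩ := exists_eq_mul_of_additive wt ⟨h, hh⟩ (fun k => -Real.log ‖F k z‖)
    (fun k hk => neg_nonneg.2 (Real.log_nonpos (norm_nonneg _) (hF.norm_le k hk z hz)))
    (fun k l hk hl => by
      rw [hF.map_add k l hk hl z hz, norm_mul, Real.log_mul (hpos k hk).ne' (hpos l hl).ne']
      ring)
  refine ⟨c, hc0, fun k hk => ?_⟩
  rw [← hc k hk, neg_neg, Real.exp_log (hpos k hk)]

/-- Schwarz–Pick for members of small weight gives Harnack's inequality for the decay rate. -/
theorem rate_mul_le (hF : InnerFamily wt F) (hsmall : ∀ ε : ℝ, 0 < ε → ∃ h, 0 < wt h ∧ wt h < ε)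
    {z w : ℂ} (hw : 0 < w.re) (hwz : w.re ≤ z.re) (him : z.im = w.im) {a b : ℝ}
    (ha : ∀ k, 0 ≤ wt k → ‖F k w‖ = Real.exp (-(wt k * a)))
    (hb : ∀ k, 0 ≤ wt k → ‖F k z‖ = Real.exp (-(wt k * b))) :
    b * w.re ≤ a * z.re := by
  have hz := hw.trans_le hwz
  have hsub : ‖z - w‖ = z.re - w.re := by
    have : z - w = ((z.re - w.re : ℝ) : ℂ) := by apply Complex.ext <;> simp [him]
    rw [this, Complex.norm_real, Real.norm_of_nonneg (by linarith)]
  have hadd : ‖z + conj w‖ = z.re + w.re := by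
    have : z + conj w = ((z.re + w.re : ℝ) : ℂ) := by apply Complex.ext <;> simp [him]
    rw [this, Complex.norm_real, Real.norm_of_nonneg (by linarith)]
  set φ : ℝ → ℝ := fun t => (z.re - w.re) * (1 - Real.exp (-(t * a)) * Real.exp (-(t * b))) -
    (Real.exp (-(t * a)) - Real.exp (-(t * b))) * (z.re + w.re) with hφ
  have hφd : HasDerivAt φ (2 * (a * z.re - b * w.re)) 0 := by
    have he : ∀ c : ℝ, HasDerivAt (fun t : ℝ => Real.exp (-(t * c))) (-c) 0 := fun c => by
      have := (((hasDerivAt_id (0 : ℝ)).mul_const c).neg).exp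
      simpa using this
    have := ((((he a).mul (he b)).const_sub 1).const_mul (z.re - w.re)).sub
      (((he a).sub (he b)).mul_const (z.re + w.re))
    refine this.congr_deriv ?_
    simp
    ring
  have hφ0 : φ 0 = 0 := by simp [hφ]
  have hslope := (hasDerivAt_iff_tendsto_slope.1 hφd).mono_left
    (nhdsWithin_mono (0 : ℝ) (fun t (ht : t ∈ Set.Ioi 0) => (Set.mem_Ioi.1 ht).ne'))
  have hfreq : ∃ᶠ t in 𝓝[>] (0 : ℝ), 0 ≤ slope φ 0 t := by
    intro hev
    obtain ⟨ε, hε, hsub'⟩ := mem_nhdsGT_iff_exists_Ioo_subset.1 hev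
    obtain ⟨h, hh, hhε⟩ := hsmall ε hε
    refine hsub' ⟨hh, hhε⟩ ?_
    have h1 := schwarzPick_halfPlane (hF.differentiableOn h hh.le)
      (fun z hz => hF.norm_le h hh.le z hz.le) hz hw
    rw [ha h hh.le, hb h hh.le, hsub, hadd] at h1
    change 0 ≤ slope φ 0 (wt h)
    rw [slope_def_field, hφ0, sub_zero, sub_zero]
    exact div_nonneg (by simp only [hφ]; linarith) hh.le
  have := ge_of_tendsto_of_frequently hslope hfreq
  linarith

/-- Rigidity: if the members of an inner family are bounded away from `0` near the boundary, they
are unimodular multiples of exponentials `z ↦ exp (-κ (wt k) z)`. By Harnack's inequality the decay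
rate grows at most linearly, and the Phragmén–Lindelöf principle shows that `κ Re z`, with `κ` the
decay rate at `1`, bounds the decay rate from above. As there is equality at the interior point
`1`, the maximum principle yields equality everywhere. -/
theorem exists_eq_mul_exp (hF : InnerFamily wt F)
    (hsmall : ∀ ε : ℝ, 0 < ε → ∃ h, 0 < wt h ∧ wt h < ε)
    (hstrip : ∀ k, 0 ≤ wt k → ∃ c : ℝ, 0 < c ∧ ∀ z : ℂ, 0 ≤ z.re → z.re ≤ 1 → c ≤ ‖F k z‖) :
    ∃ κ : ℝ, ∀ k, 0 ≤ wt k → ∀ z : ℂ, 0 ≤ z.re →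
      F k z = F k 0 * Complex.exp (-(wt k * κ * z)) := by
  choose! lam hlam0 hlam using fun (z : ℂ) (hz : 0 ≤ z.re) => hF.exists_rate hsmall hz
  refine ⟨lam 1, fun k hk => ?_⟩
  have hcl : closure {z : ℂ | 0 < z.re} = {z | 0 ≤ z.re} := Complex.closure_setOfPred_lt_re 0
  set G : ℂ → ℂ := fun z => (F k z)⁻¹ * Complex.exp (-(wt k * lam 1 * z)) with hG
  have hGnorm : ∀ z : ℂ, 0 ≤ z.re → ‖G z‖ = Real.exp (wt k * (lam z - lam 1 * z.re)) := by
    intro z hz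
    simp only [hG]
    rw [norm_mul, norm_inv, hlam z hz k hk, Complex.norm_exp, ← Real.exp_neg, ← Real.exp_add]
    congr 1
    simp
    ring
  have hGd : DiffContOnCl ℂ G {z | 0 < z.re} := by
    refine ⟨((hF.differentiableOn k hk).inv fun z hz => hF.ne_zero hsmall hk hz).mul
      (by fun_prop), ?_⟩
    rw [hcl]
    exact ((hF.continuousOn k hk).inv₀ fun z hz => hF.ne_zero' hsmall hk hz).mul (by fun_prop)
  obtain ⟨c, hc, hcz⟩ := hstrip k hk
  set M := -Real.log c
  have hM : ∀ z : ℂ, 0 ≤ z.re → z.re ≤ 1 → wt k * lam z ≤ M := by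
    intro z hz hz1
    have := Real.log_le_log hc (hcz z hz hz1)
    rw [hlam z hz k hk, Real.log_exp] at this
    linarith
  have hM0 : 0 ≤ M := (mul_nonneg hk (hlam0 1 (by simp))).trans (hM 1 (by simp) (by simp))
  have hgrowth : ∀ z : ℂ, 0 ≤ z.re → wt k * lam z ≤ M + M * ‖z‖ := by
    intro z hz
    rcases le_total z.re 1 with h | h
    · exact (hM z hz h).trans (le_add_of_nonneg_right (by positivity))
    · have h1 : 0 ≤ (⟨1, z.im⟩ : ℂ).re := by simp
      have h2 := hF.rate_mul_le hsmall (w := ⟨1, z.im⟩) (z := z) (by simp) (by simpa using h) rfl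
        (hlam _ h1) (hlam z hz)
      simp only [mul_one] at h2
      have h3 := hM ⟨1, z.im⟩ h1 (by simp)
      have h4 : z.re ≤ ‖z‖ := Complex.re_le_norm z
      calc wt k * lam z ≤ wt k * (lam ⟨1, z.im⟩ * z.re) := mul_le_mul_of_nonneg_left h2 hk
        _ = (wt k * lam ⟨1, z.im⟩) * z.re := by ring
        _ ≤ M * ‖z‖ := mul_le_mul h3 h4 hz hM0
        _ ≤ M + M * ‖z‖ := le_add_of_nonneg_left hM0
  have hle : ∀ z : ℂ, 0 ≤ z.re → ‖G z‖ ≤ 1 := by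
    intro z hz
    refine PhragmenLindelof.right_half_plane_of_bounded_on_real hGd
      ⟨1, by norm_num, M, ?_⟩ ?_ ?_ hz
    · refine Asymptotics.IsBigO.of_bound (Real.exp M) ?_
      refine Filter.mem_inf_of_right ?_
      rw [mem_principal]
      intro z hz
      have hz : 0 ≤ z.re := (Set.mem_ofPred.1 hz).le
      simp only [Set.mem_ofPred]
      rw [hGnorm z hz, Real.norm_of_nonneg (Real.exp_pos _).le, ← Real.exp_add, Real.rpow_one]
      refine Real.exp_le_exp.2 ?_
      have := hgrowth z hz
      have h1 := mul_nonneg hk (mul_nonneg (hlam0 1 (by simp)) hz)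
      linarith
    · refine isBoundedUnder_of_eventually_le (a := 1) ?_
      filter_upwards [eventually_ge_atTop 1] with s hs
      have hs0 : 0 ≤ (s : ℂ).re := by simp; linarith
      have h2 := hF.rate_mul_le hsmall (w := 1) (z := s) (by simp) (by simpa using hs) (by simp)
        (hlam _ (by simp)) (hlam s hs0)
      rw [hGnorm s hs0, Real.exp_le_one_iff]
      refine mul_nonpos_of_nonneg_of_nonpos hk ?_
      simp at h2 ⊢
      exact h2
    · intro x
      have hx : (x * Complex.I).re = 0 := by simp
      simp only [hG]
      rw [norm_mul, norm_inv, hF.norm_boundary k hk _ hx, Complex.norm_exp]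
      simp
  have hmax : IsMaxOn (norm ∘ G) {z | 0 < z.re} 1 := by
    intro z hz
    have h1 : ‖G 1‖ = 1 := by rw [hGnorm 1 (by simp)]; simp
    simpa [h1] using hle z (Set.mem_ofPred.1 hz).le
  have hconst := Complex.eqOn_closure_of_isPreconnected_of_isMaxOn_norm
    (convex_halfSpace_re_gt 0).isPreconnected (isOpen_lt continuous_const Complex.continuous_re)
    hGd (by simp) hmax
  rw [hcl] at hconst
  intro z hz
  have h1 : G z = G 0 := (hconst hz).trans (hconst (by simp : (0 : ℂ) ∈ {z : ℂ | 0 ≤ z.re})).symm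
  simp only [hG] at h1
  have h2 := hF.ne_zero' hsmall hk hz
  have h3 := hF.ne_zero' hsmall hk (z := 0) (by simp)
  rw [mul_zero, neg_zero, Complex.exp_zero, mul_one] at h1
  field_simp at h1
  rw [← h1]
  ring

end InnerFamily

/-! ### Extension of the functions of the algebra to half-planes -/

theorem mem_bigDiscAlgebra_iff {α : ℝ} {f : C(Torus2, ℂ)} :
    f ∈ bigDiscAlgebra α ↔ ∀ k, weight α k < 0 → fourierCoeffTorus f k.1 k.2 = 0 :=
  ⟨fun h k hk => h k.1 k.2 hk, fun h m n hk => h (m, n) hk⟩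

theorem torusChar_mem_bigDiscAlgebra {α : ℝ} {k : ℤ × ℤ} (hk : 0 ≤ weight α k) :
    torusChar k ∈ bigDiscAlgebra α :=
  mem_bigDiscAlgebra_iff.2 fun l hl =>
    fourierCoeffTorus_torusChar_of_ne fun e => absurd hl (by rw [← e]; exact hk.not_gt)

theorem isClosed_bigDiscAlgebra (α : ℝ) : IsClosed (bigDiscAlgebra α : Set C(Torus2, ℂ)) := by
  have h : (bigDiscAlgebra α : Set C(Torus2, ℂ)) =
      ⋂ k, ⋂ (_ : weight α k < 0), fourierCoeffCLM k ⁻¹' {0} := by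
    ext f
    simp only [SetLike.mem_coe, mem_bigDiscAlgebra_iff, Set.mem_iInter, Set.mem_preimage,
      Set.mem_singleton_iff, fourierCoeffCLM_apply]
  rw [h]
  exact isClosed_iInter fun k => isClosed_iInter fun _ =>
    isClosed_singleton.preimage (fourierCoeffCLM k).continuous

/-- The characters of nonnegative weight span a dense subspace of the algebra. -/
theorem mem_closure_span_of_mem_bigDiscAlgebra {α : ℝ} {f : C(Torus2, ℂ)}
    (hf : f ∈ bigDiscAlgebra α) :
    f ∈ (Submodule.span ℂ (torusChar '' {k | 0 ≤ weight α k})).topologicalClosure := by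
  refine Submodule.topologicalClosure_mono (Submodule.span_mono (Set.image_mono fun k hk => ?_))
    (mem_closure_span_torusChar f)
  by_contra h
  exact hk (mem_bigDiscAlgebra_iff.1 hf k (not_le.1 h))

/-- A bounded holomorphic function on the right half-plane, continuous up to the boundary, is
bounded by the supremum of its boundary values. -/
theorem norm_le_of_boundary {F : ℂ → ℂ} (hc : ContinuousOn F {z | 0 ≤ z.re})
    (hd : DifferentiableOn ℂ F {z | 0 < z.re}) {M : ℝ} (hM : ∀ z : ℂ, 0 ≤ z.re → ‖F z‖ ≤ M)
    {C : ℝ} (hC : ∀ t : ℝ, ‖F (t * Complex.I)‖ ≤ C) {z : ℂ} (hz : 0 ≤ z.re) : ‖F z‖ ≤ C := by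
  refine PhragmenLindelof.right_half_plane_of_bounded_on_real
    ⟨hd, by rwa [Complex.closure_setOfPred_lt_re]⟩ ⟨1, by norm_num, 0, ?_⟩ ?_ hC hz
  · refine Asymptotics.IsBigO.of_bound M (Filter.mem_inf_of_right ?_)
    rw [mem_principal]
    intro z hz
    simpa using hM z (Set.mem_ofPred.1 hz).le
  · refine isBoundedUnder_of_eventually_le (a := M) ?_
    filter_upwards [eventually_ge_atTop 0] with s hs
    exact hM _ (by simpa using hs)

theorem eq_of_boundary_eq {F G : ℂ → ℂ} (hFc : ContinuousOn F {z | 0 ≤ z.re})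
    (hFd : DifferentiableOn ℂ F {z | 0 < z.re}) (hGc : ContinuousOn G {z | 0 ≤ z.re})
    (hGd : DifferentiableOn ℂ G {z | 0 < z.re}) {M N : ℝ} (hM : ∀ z : ℂ, 0 ≤ z.re → ‖F z‖ ≤ M)
    (hN : ∀ z : ℂ, 0 ≤ z.re → ‖G z‖ ≤ N)
    (h : ∀ t : ℝ, F (t * Complex.I) = G (t * Complex.I)) {z : ℂ} (hz : 0 ≤ z.re) :
    F z = G z := by
  have h1 := norm_le_of_boundary (hFc.sub hGc) (hFd.sub hGd) (M := M + N) (C := 0)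
    (fun z hz => (norm_sub_le _ _).trans (add_le_add (hM z hz) (hN z hz)))
    (fun t => by simp [h t]) hz
  exact sub_eq_zero.1 (norm_le_zero_iff.1 h1)

/-- `F` extends `f` holomorphically along the flow: for each `x` the function `F x` is bounded and
continuous on the closed right half-plane, holomorphic inside, with boundary values
`F x (i t) = f (flow (-t) * x)`. The sign makes the extension of the character `torusChar k`
equal to `exp (-(weight α k) z) * torusChar k x`, which is bounded exactly if the weight is
nonnegative. -/
structure IsFlowExtension (α : ℝ) (f : C(Torus2, ℂ)) (F : Torus2 → ℂ → ℂ) : Prop where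
  continuousOn : ContinuousOn (fun p : Torus2 × ℂ => F p.1 p.2) {p | 0 ≤ p.2.re}
  differentiableOn : ∀ x, DifferentiableOn ℂ (F x) {z | 0 < z.re}
  boundary : ∀ x (t : ℝ), F x (t * Complex.I) = f (flow α (-t) * x)
  bounded : ∃ M : ℝ, ∀ x (z : ℂ), 0 ≤ z.re → ‖F x z‖ ≤ M

namespace IsFlowExtension

variable {α : ℝ} {f g : C(Torus2, ℂ)} {F G : Torus2 → ℂ → ℂ}

theorem continuousOn_right (hF : IsFlowExtension α f F) (x : Torus2) :
    ContinuousOn (F x) {z | 0 ≤ z.re} :=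
  hF.continuousOn.comp (f := fun z => (x, z)) (by fun_prop) fun _ hz => hz

theorem norm_le (hF : IsFlowExtension α f F) (x : Torus2) {z : ℂ} (hz : 0 ≤ z.re) :
    ‖F x z‖ ≤ ‖f‖ := by
  obtain ⟨M, hM⟩ := hF.bounded
  exact norm_le_of_boundary (hF.continuousOn_right x) (hF.differentiableOn x) (hM x)
    (fun t => by rw [hF.boundary]; exact f.norm_coe_le_norm _) hz

theorem congr (hF : IsFlowExtension α f F) (hG : IsFlowExtension α f G) (x : Torus2) {z : ℂ}
    (hz : 0 ≤ z.re) : F x z = G x z :=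
  eq_of_boundary_eq (hF.continuousOn_right x) (hF.differentiableOn x) (hG.continuousOn_right x)
    (hG.differentiableOn x) (fun _ h => hF.norm_le x h) (fun _ h => hG.norm_le x h)
    (fun t => by rw [hF.boundary, hG.boundary]) hz

theorem add (hF : IsFlowExtension α f F) (hG : IsFlowExtension α g G) :
    IsFlowExtension α (f + g) (fun x z => F x z + G x z) where
  continuousOn := hF.continuousOn.add hG.continuousOn
  differentiableOn x := (hF.differentiableOn x).add (hG.differentiableOn x)
  boundary x t := by rw [hF.boundary, hG.boundary]; rfl
  bounded := ⟨‖f‖ + ‖g‖, fun x z hz =>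
    (norm_add_le _ _).trans (add_le_add (hF.norm_le x hz) (hG.norm_le x hz))⟩

theorem mul (hF : IsFlowExtension α f F) (hG : IsFlowExtension α g G) :
    IsFlowExtension α (f * g) (fun x z => F x z * G x z) where
  continuousOn := hF.continuousOn.mul hG.continuousOn
  differentiableOn x := (hF.differentiableOn x).mul (hG.differentiableOn x)
  boundary x t := by rw [hF.boundary, hG.boundary]; rfl
  bounded := ⟨‖f‖ * ‖g‖, fun x z hz => by
    rw [norm_mul]
    exact mul_le_mul (hF.norm_le x hz) (hG.norm_le x hz) (norm_nonneg _) (norm_nonneg _)⟩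

theorem smul (hF : IsFlowExtension α f F) (a : ℂ) :
    IsFlowExtension α (a • f) (fun x z => a * F x z) where
  continuousOn := hF.continuousOn.const_mul a
  differentiableOn x := (hF.differentiableOn x).const_mul a
  boundary x t := by rw [hF.boundary]; rfl
  bounded := ⟨‖a‖ * ‖f‖, fun x z hz => by
    rw [norm_mul]
    exact mul_le_mul_of_nonneg_left (hF.norm_le x hz) (norm_nonneg _)⟩

theorem sub (hF : IsFlowExtension α f F) (hG : IsFlowExtension α g G) :
    IsFlowExtension α (f - g) (fun x z => F x z - G x z) := by
  have h := hF.add (hG.smul (-1))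
  simpa [sub_eq_add_neg] using h

theorem torusChar {k : ℤ × ℤ} (hk : 0 ≤ weight α k) :
    IsFlowExtension α (torusChar k)
      (fun x z => Complex.exp (-(weight α k * z)) * _root_.torusChar k x) where
  continuousOn := Continuous.continuousOn (by fun_prop)
  differentiableOn x := by fun_prop
  boundary x t := by
    rw [torusChar_apply_mul, torusChar_flow]
    congr 2
    push_cast
    ring
  bounded := ⟨1, fun x z hz => by
    rw [norm_mul, norm_torusChar_apply, mul_one, Complex.norm_exp, Real.exp_le_one_iff]
    simpa using mul_nonneg hk hz⟩

/-- Flowing along `x` is moving parallel to the boundary. -/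
theorem apply_add_mul_I (hF : IsFlowExtension α f F) (x : Torus2) (t : ℝ) {z : ℂ}
    (hz : 0 ≤ z.re) : F x (z + t * Complex.I) = F (flow α (-t) * x) z := by
  refine eq_of_boundary_eq (F := fun z => F x (z + t * Complex.I)) (M := ‖f‖) (N := ‖f‖)
    ?_ ?_ (hF.continuousOn_right _) (hF.differentiableOn _) (fun z hz => hF.norm_le x (by simpa))
    (fun z hz => hF.norm_le _ hz) (fun s => ?_) hz
  · exact (hF.continuousOn_right x).comp (by fun_prop) fun z hz => by simpa using hz
  · exact (hF.differentiableOn x).comp (by fun_prop) fun z hz => by simpa using hz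
  · rw [hF.boundary, ← add_mul, ← Complex.ofReal_add, hF.boundary, neg_add, flow_add, mul_assoc]

/-- Uniform limits of functions with holomorphic extensions along the flow have such
extensions. -/
theorem of_tendsto {fn : ℕ → C(Torus2, ℂ)} {Fn : ℕ → Torus2 → ℂ → ℂ}
    (h : ∀ n, IsFlowExtension α (fn n) (Fn n)) (hlim : Tendsto fn atTop (𝓝 f)) :
    ∃ F, IsFlowExtension α f F := by
  set S : Set (Torus2 × ℂ) := {p | 0 ≤ p.2.re}
  have hU : UniformCauchySeqOn (fun n (p : Torus2 × ℂ) => Fn n p.1 p.2) atTop S := by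
    rw [Metric.uniformCauchySeqOn_iff]
    intro ε hε
    obtain ⟨N, hN⟩ := Metric.cauchySeq_iff.1 hlim.cauchySeq ε hε
    refine ⟨N, fun m hm n hn p hp => ?_⟩
    rw [dist_eq_norm]
    exact (((h m).sub (h n)).norm_le p.1 hp).trans_lt (by simpa [dist_eq_norm] using hN m hm n hn)
  have hpt : ∀ p : Torus2 × ℂ, p ∈ S → ∃ v, Tendsto (fun n => Fn n p.1 p.2) atTop (𝓝 v) :=
    fun p hp => cauchySeq_tendsto_of_complete (hU.cauchySeq hp)
  choose! L hL using hpt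
  have hT : TendstoUniformlyOn (fun n (p : Torus2 × ℂ) => Fn n p.1 p.2) L atTop S :=
    hU.tendstoUniformlyOn_of_tendsto hL
  refine ⟨fun x z => L (x, z), ?_, ?_, ?_, ?_⟩
  · exact hT.continuousOn (Frequently.of_forall fun n => (h n).continuousOn)
  · intro x
    have hTx : TendstoUniformlyOn (fun n z => Fn n x z) (fun z => L (x, z)) atTop
        {z | 0 < z.re} :=
      (hT.comp (fun z => (x, z))).mono fun z hz => (Set.mem_ofPred.1 hz).le
    exact hTx.tendstoLocallyUniformlyOn.differentiableOn
      (Eventually.of_forall fun n => (h n).differentiableOn x)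
      (isOpen_lt continuous_const Complex.continuous_re)
  · intro x t
    refine tendsto_nhds_unique (hL (x, t * Complex.I) (by simp [S])) ?_
    simp only [(h _).boundary]
    exact ((continuous_eval_const _).tendsto f).comp hlim
  · obtain ⟨M, hM⟩ := hlim.norm.bddAbove_range
    refine ⟨M, fun x z hz => ?_⟩
    exact le_of_tendsto (hL (x, z) hz).norm (Eventually.of_forall fun n =>
      ((h n).norm_le x hz).trans (hM ⟨n, rfl⟩))

end IsFlowExtension

theorem exists_isFlowExtension {α : ℝ} {f : C(Torus2, ℂ)} (hf : f ∈ bigDiscAlgebra α) :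
    ∃ F, IsFlowExtension α f F := by
  have hspan : ∀ g ∈ Submodule.span ℂ (torusChar '' {k | 0 ≤ weight α k}),
      ∃ F, IsFlowExtension α g F := by
    intro g hg
    induction hg using Submodule.span_induction with
    | mem g h =>
      obtain ⟨k, hk, rfl⟩ := h
      exact ⟨_, IsFlowExtension.torusChar hk⟩
    | zero => exact ⟨fun _ _ => 0, by fun_prop, fun x => by fun_prop, fun x t => rfl, 0, by simp⟩
    | add g g' _ _ h h' =>
      obtain ⟨F, hF⟩ := h
      obtain ⟨F', hF'⟩ := h'
      exact ⟨_, hF.add hF'⟩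
    | smul a g _ h =>
      obtain ⟨F, hF⟩ := h
      exact ⟨_, hF.smul a⟩
  obtain ⟨fn, hfn, hlim⟩ := mem_closure_iff_seq_limit.1 (mem_closure_span_of_mem_bigDiscAlgebra hf)
  choose Fn hFn using fun n => hspan (fn n) (hfn n)
  exact IsFlowExtension.of_tendsto hFn hlim

/-- A multiplicative family of unimodular functions in the algebra, indexed by the characters of
nonnegative weight, consists of multiples of characters, and it multiplies the weight by a
constant. The extensions along each orbit of the flow form an inner family, hence are exponentials;
the exponent is a continuous function that is invariant under the flow, hence constant, and so the
members of the family are eigenfunctions of the flow. -/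
theorem exists_scaling_of_unimodular {α : ℝ} (hirr : Irrational α) (u : ℤ × ℤ → C(Torus2, ℂ))
    (hmem : ∀ k, 0 ≤ weight α k → u k ∈ bigDiscAlgebra α) (hone : u 0 = 1)
    (hadd : ∀ k l, 0 ≤ weight α k → 0 ≤ weight α l → u (k + l) = u k * u l)
    (hnorm : ∀ k, 0 ≤ weight α k → ∀ x, ‖u k x‖ = 1) :
    ∃ κ : ℝ, ∀ k, 0 ≤ weight α k →
      ∃ l, weight α l = κ * weight α k ∧ ∃ a : ℂ, u k = a • torusChar l := by
  choose! F hF using fun k (hk : 0 ≤ weight α k) => exists_isFlowExtension (hmem k hk)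
  have hu : ∀ k, 0 ≤ weight α k → ‖u k‖ ≤ 1 := fun k hk =>
    (ContinuousMap.norm_le _ zero_le_one).2 fun x => (hnorm k hk x).le
  have hbd : ∀ k, 0 ≤ weight α k → ∀ x (z : ℂ), z.re = 0 →
      F k x z = u k (flow α (-z.im) * x) := fun k hk x z hz => by
    rw [← (hF k hk).boundary]
    congr 1
    apply Complex.ext <;> simp [hz]
  have hsmall : ∀ ε : ℝ, 0 < ε → ∃ h, 0 < weight α h ∧ weight α h < ε :=
    fun ε hε => exists_weight_mem_Ioo hirr hε
  have hinner : ∀ x, InnerFamily (weight α) (fun k z => F k x z) := fun x =>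
    { map_zero := fun z hz => by
        have h0 : 0 ≤ weight α 0 := by simp
        have h1 := IsFlowExtension.torusChar h0
        rw [torusChar_zero, ← hone] at h1
        rw [(hF 0 h0).congr h1 x hz]
        simp [hone]
      map_add := fun k l hk hl z hz => by
        have hkl : 0 ≤ weight α (k + l) := by rw [map_add]; exact add_nonneg hk hl
        have h1 := (hF k hk).mul (hF l hl)
        rw [← hadd k l hk hl] at h1
        exact (hF _ hkl).congr h1 x hz
      continuousOn := fun k hk => (hF k hk).continuousOn_right x
      differentiableOn := fun k hk => (hF k hk).differentiableOn x
      norm_le := fun k hk z hz => ((hF k hk).norm_le x hz).trans (hu k hk)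
      norm_boundary := fun k hk z hz => by rw [hbd k hk x z hz, hnorm k hk] }
  have hstrip : ∀ k, 0 ≤ weight α k → ∃ c : ℝ, 0 < c ∧ ∀ x (z : ℂ), 0 ≤ z.re → z.re ≤ 1 →
      c ≤ ‖F k x z‖ := by
    intro k hk
    have hcont : ContinuousOn (fun p : Torus2 × ℝ => ‖F k p.1 p.2‖)
        (Set.univ ×ˢ Set.Icc (0 : ℝ) 1) :=
      ((hF k hk).continuousOn.comp (f := fun p : Torus2 × ℝ => (p.1, (p.2 : ℂ))) (by fun_prop)
        fun p hp => by simpa using hp.2.1).norm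
    obtain ⟨p, hp, hmin⟩ := (isCompact_univ.prod isCompact_Icc).exists_isMinOn
      ⟨((1 : Torus2), (0 : ℝ)), by simp⟩ hcont
    refine ⟨‖F k p.1 p.2‖,
      norm_pos_iff.2 ((hinner p.1).ne_zero' hsmall hk (by simpa using hp.2.1)), fun x z h0 h1 => ?_⟩
    have h2 := (hF k hk).apply_add_mul_I x z.im (z := (z.re : ℂ)) (by simpa using h0)
    rw [Complex.re_add_im] at h2
    rw [h2]
    exact hmin (a := (flow α (-z.im) * x, z.re)) ⟨trivial, h0, h1⟩
  choose κ hκ using fun x => (hinner x).exists_eq_mul_exp hsmall fun k hk => by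
    obtain ⟨c, hc, h⟩ := hstrip k hk
    exact ⟨c, hc, h x⟩
  -- The rate `κ x` is read off from the member of weight `1`.
  have hw1 : weight α (1, 0) = 1 := by simp [weight_apply]
  have hw1' : 0 ≤ weight α (1, 0) := by rw [hw1]; exact zero_le_one
  have hF0 : ∀ k, 0 ≤ weight α k → ∀ x, F k x 0 = u k x := fun k hk x => by
    have := hbd k hk x 0 rfl
    simpa [flow_zero] using this
  have hκnorm : ∀ x t, ‖F (1, 0) x (1 + (t : ℝ) * Complex.I)‖ = Real.exp (-κ x) := fun x t => by
    rw [hκ x _ hw1' _ (by simp), norm_mul, hF0 _ hw1', hnorm _ hw1', one_mul, Complex.norm_exp, hw1]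
    simp
  have hκlog : ∀ x, κ x = -Real.log ‖F (1, 0) x 1‖ := fun x => by
    have := hκnorm x 0
    simp only [Complex.ofReal_zero, zero_mul, add_zero] at this
    rw [this, Real.log_exp, neg_neg]
  have hκcont : Continuous κ := by
    rw [funext hκlog]
    have h1 : Continuous fun x => F (1, 0) x 1 :=
      (hF _ hw1').continuousOn.comp_continuous (f := fun x : Torus2 => (x, (1 : ℂ)))
        (by fun_prop) (by simp)
    exact (h1.norm.log fun x =>
      norm_ne_zero_iff.2 ((hinner x).ne_zero' hsmall hw1' (by simp))).neg
  have hκflow : ∀ t x, κ (flow α t * x) = κ x := fun t x => by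
    have h1 := hκnorm x (-t)
    rw [(hF _ hw1').apply_add_mul_I x (-t) (by simp), neg_neg] at h1
    rw [hκlog, h1, Real.log_exp, neg_neg]
  have hκc : ∃ c, ∀ x, κ x = c := by
    let Kf : C(Torus2, ℂ) := ⟨fun x => (κ x : ℂ), by fun_prop⟩
    obtain ⟨a, ha⟩ := eq_smul_torusChar_of_spectrum Kf 0 fun l hl => by
      by_contra h0
      have := weight_eq_of_flow_eigenfunction (α := α) (ω := 0) (f := Kf)
        (fun t x => by simp [Kf, hκflow]) h0
      exact hl (weight_injective hirr (by rw [this, map_zero]))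
    refine ⟨a.re, fun x => ?_⟩
    have := congrArg Complex.re (DFunLike.congr_fun ha x)
    simpa [Kf, torusChar_zero] using this
  obtain ⟨c, hc⟩ := hκc
  refine ⟨c, fun k hk => ?_⟩
  have huk : u k ≠ 0 := fun h => by
    have := hnorm k hk 1
    rw [h] at this
    simp at this
  obtain ⟨l, hl, a, ha⟩ := exists_eq_smul_torusChar_of_flow_eigenfunction hirr
    (ω := c * weight α k) huk fun t x => by
      have h1 := hκ x k hk ((-t : ℝ) * Complex.I) (by simp)
      rw [(hF k hk).boundary, neg_neg, hF0 k hk, hc] at h1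
      rw [h1, mul_comm]
      congr 2
      push_cast
      ring
  exact ⟨l, hl, a, ha⟩

/-! ### Isometric automorphisms scale the weights -/

/-- The character of nonnegative weight `weight α k` as an element of the algebra. -/
noncomputable def analyticChar {α : ℝ} (k : ℤ × ℤ) (hk : 0 ≤ weight α k) : bigDiscAlgebra α :=
  ⟨torusChar k, torusChar_mem_bigDiscAlgebra hk⟩

theorem dense_span_analyticChar (α : ℝ) :
    Dense (Submodule.span ℂ {f : bigDiscAlgebra α | ∃ k hk, f = analyticChar k hk} :
      Set (bigDiscAlgebra α)) := by
  intro f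
  rw [Topology.IsInducing.subtypeVal.closure_eq_preimage_closure_image, Set.mem_preimage]
  have h1 := mem_closure_span_of_mem_bigDiscAlgebra f.2
  refine closure_mono ?_ h1
  have h2 : Submodule.span ℂ (torusChar '' {k | 0 ≤ weight α k}) ≤
      (Submodule.span ℂ {f : bigDiscAlgebra α | ∃ k hk, f = analyticChar k hk}).map
        (bigDiscAlgebra α).val.toLinearMap := by
    refine Submodule.span_le.2 ?_
    rintro _ ⟨k, hk, rfl⟩
    exact ⟨analyticChar k hk, Submodule.subset_span ⟨k, hk, rfl⟩, rfl⟩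
  exact h2

/-- Continuous linear maps on the algebra are determined by their values on characters. -/
theorem eq_of_eq_on_analyticChar {α : ℝ} {S T : bigDiscAlgebra α →ₗ[ℂ] C(Torus2, ℂ)}
    (hS : Continuous S) (hT : Continuous T)
    (h : ∀ k hk, S (analyticChar k hk) = T (analyticChar k hk)) : S = T := by
  have h1 : Submodule.span ℂ {f : bigDiscAlgebra α | ∃ k hk, f = analyticChar k hk} ≤
      LinearMap.eqLocus S T := by
    refine Submodule.span_le.2 ?_
    rintro _ ⟨k, hk, rfl⟩
    exact h k hk
  have h2 := Continuous.ext_on (dense_span_analyticChar α) hS hT fun f hf => h1 hf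
  exact LinearMap.ext fun f => congrFun h2 f

theorem comp_mem_bigDiscAlgebra {α : ℝ} (φ : C(Torus2, Torus2))
    (h : ∀ k, 0 ≤ weight α k → (torusChar k).comp φ ∈ bigDiscAlgebra α) {f : C(Torus2, ℂ)}
    (hf : f ∈ bigDiscAlgebra α) : f.comp φ ∈ bigDiscAlgebra α := by
  have h1 : (Submodule.span ℂ (torusChar '' {k | 0 ≤ weight α k})).topologicalClosure ≤
      (Subalgebra.toSubmodule (bigDiscAlgebra α)).comap
        (ContinuousMap.compRightAlgHom ℂ ℂ φ).toLinearMap := by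
    refine Submodule.topologicalClosure_minimal _ (Submodule.span_le.2 ?_)
      ((isClosed_bigDiscAlgebra α).preimage (ContinuousMap.continuous_precomp φ))
    rintro _ ⟨k, hk, rfl⟩
    exact h k hk
  exact h1 (mem_closure_span_of_mem_bigDiscAlgebra hf)

theorem norm_coe_isometricAut {α : ℝ} (Φ : isometricAut α) (f : bigDiscAlgebra α) :
    ‖(Φ.1 f : C(Torus2, ℂ))‖ = ‖(f : C(Torus2, ℂ))‖ := by
  have h : dist (Φ.1 f) (Φ.1 0) = dist f 0 := (show Isometry Φ.1 from Φ.2).dist_eq f 0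
  rw [map_zero, Subtype.dist_eq, Subtype.dist_eq] at h
  simpa using h

theorem smul_torusChar_injective {a b : ℂ} (ha : a ≠ 0) {k l : ℤ × ℤ}
    (h : a • torusChar k = b • torusChar l) : k = l := by
  by_contra hne
  have h1 := fourierCoeffTorus_smul a (torusChar k) k
  rw [h, fourierCoeffTorus_smul, fourierCoeffTorus_torusChar_self,
    fourierCoeffTorus_torusChar_of_ne (Ne.symm hne), mul_zero, mul_one] at h1
  exact ha h1.symm

theorem weight_nonneg_of_smul_mem {α : ℝ} {a : ℂ} (ha : a ≠ 0) {k : ℤ × ℤ}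
    (h : a • torusChar k ∈ bigDiscAlgebra α) : 0 ≤ weight α k := by
  by_contra! hk
  have h1 := mem_bigDiscAlgebra_iff.1 h k hk
  rw [fourierCoeffTorus_smul, fourierCoeffTorus_torusChar_self, mul_one] at h1
  exact ha h1

theorem eq_one_of_norm_one_add_add {a b : ℂ} (ha : ‖a‖ = 1) (hb : ‖b‖ = 1)
    (h : 3 ≤ ‖1 + a + b‖) : a = 1 := by
  have h1 : 2 ≤ ‖1 + a‖ := by linarith [norm_add_le (1 + a) b]
  have h2 : ‖1 + a‖ ^ 2 = 1 + ‖a‖ ^ 2 + 2 * a.re := by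
    simp only [Complex.sq_norm, Complex.normSq_apply]
    simp
    ring
  have h3 : ‖a‖ ^ 2 = a.re ^ 2 + a.im ^ 2 := by
    simp only [Complex.sq_norm, Complex.normSq_apply]
    ring
  rw [ha] at h2 h3
  have h4 : 1 ≤ a.re := by nlinarith
  apply Complex.ext
  · simp only [Complex.one_re]; nlinarith
  · simp only [Complex.one_im]; nlinarith

theorem eq_one_of_torusChar_eq_one {c : Torus2} (h₁ : torusChar (1, 0) c = 1)
    (h₂ : torusChar (0, 1) c = 1) : c = 1 := by
  rw [torusChar_apply] at h₁ h₂
  refine Prod.ext (Circle.coe_eq_one.1 ?_) (Circle.coe_eq_one.1 ?_)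
  · simpa only [zpow_one, zpow_zero, mul_one] using h₁
  · simpa only [zpow_one, zpow_zero, one_mul] using h₂

/-- The algebra contains, for each point `x` of the torus, a function whose modulus attains its
maximum at `x` only. -/
theorem exists_peak {α : ℝ} (hpos : 0 < α) (x : Torus2) :
    ∃ p ∈ bigDiscAlgebra α, ‖p‖ = 3 ∧ ∀ y, 3 ≤ ‖p y‖ → y = x := by
  set p : C(Torus2, ℂ) := 1 + torusTranslate x⁻¹ (torusChar (1, 0)) +
    torusTranslate x⁻¹ (torusChar (0, 1)) with hp
  have hpy : ∀ y, p y = 1 + torusChar (1, 0) (x⁻¹ * y) + torusChar (0, 1) (x⁻¹ * y) :=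
    fun y => rfl
  refine ⟨p, ?_, le_antisymm ?_ ?_, fun y hy => ?_⟩
  · rw [hp, torusTranslate_torusChar, torusTranslate_torusChar]
    refine add_mem (add_mem (one_mem _) ((bigDiscAlgebra α).smul_mem ?_ _))
      ((bigDiscAlgebra α).smul_mem ?_ _) <;> refine torusChar_mem_bigDiscAlgebra ?_
    · simp [weight_apply]
    · simpa [weight_apply] using hpos.le
  · refine (ContinuousMap.norm_le _ (by norm_num)).2 fun y => ?_
    rw [hpy]
    refine (norm_add₃_le).trans ?_
    rw [norm_torusChar_apply, norm_torusChar_apply, norm_one]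
    norm_num
  · refine le_trans ?_ (p.norm_coe_le_norm x)
    rw [hpy, inv_mul_cancel, torusChar_apply_one, torusChar_apply_one]
    norm_num
  · rw [hpy] at hy
    have h1 := eq_one_of_norm_one_add_add (norm_torusChar_apply _ _) (norm_torusChar_apply _ _) hy
    rw [add_right_comm] at hy
    have h2 := eq_one_of_norm_one_add_add (norm_torusChar_apply _ _) (norm_torusChar_apply _ _) hy
    exact (inv_mul_eq_one.1 (eq_one_of_torusChar_eq_one h1 h2)).symm

/-- An isometric automorphism maps characters to unimodular functions: multiplication by a
character preserves norms, hence so does multiplication by its image, and this can be tested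
on functions that peak at a given point. -/
theorem norm_isometricAut_analyticChar {α : ℝ} (hpos : 0 < α) (Φ : isometricAut α) {k : ℤ × ℤ}
    (hk : 0 ≤ weight α k) (x : Torus2) :
    ‖(Φ.1 (analyticChar k hk) : C(Torus2, ℂ)) x‖ = 1 := by
  set v := Φ.1 (analyticChar k hk) with hv
  have hvn : ‖(v : C(Torus2, ℂ))‖ = 1 := by
    rw [hv, norm_coe_isometricAut]; exact norm_torusChar k
  have hle : ∀ y, ‖(v : C(Torus2, ℂ)) y‖ ≤ 1 := fun y =>
    hvn ▸ (v : C(Torus2, ℂ)).norm_coe_le_norm y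
  obtain ⟨p, hp, hp3, hpx⟩ := exists_peak hpos x
  have hmul : ∀ q : C(Torus2, ℂ), ‖q * torusChar k‖ = ‖q‖ := fun q => by
    simp only [ContinuousMap.norm_eq_iSup_norm, ContinuousMap.mul_apply, norm_mul,
      norm_torusChar_apply, mul_one]
  obtain ⟨q, hq⟩ := Φ.1.surjective ⟨p, hp⟩
  have h1 : ‖(p * v : C(Torus2, ℂ))‖ = 3 := by
    have h2 : (p * v : C(Torus2, ℂ)) = (Φ.1 (q * analyticChar k hk) : C(Torus2, ℂ)) := by
      rw [map_mul, hq]; rfl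
    rw [h2, norm_coe_isometricAut]
    have h3 := norm_coe_isometricAut Φ q
    rw [hq] at h3
    exact (hmul q).trans (h3.symm.trans hp3)
  obtain ⟨y, -, hy⟩ := isCompact_univ.exists_isMaxOn Set.univ_nonempty
    (p * v : C(Torus2, ℂ)).continuous.norm.continuousOn
  have h4 : 3 ≤ ‖p y‖ * ‖(v : C(Torus2, ℂ)) y‖ := by
    rw [← norm_mul, ← h1]
    exact (ContinuousMap.norm_le _ (norm_nonneg _)).2 fun z => hy (Set.mem_univ z)
  have h5 : ‖p y‖ ≤ 3 := hp3 ▸ p.norm_coe_le_norm y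
  have h6 : y = x := hpx y (by nlinarith [hle y, norm_nonneg (p y)])
  rw [← h6]
  refine le_antisymm (hle y) ?_
  nlinarith [hle y, norm_nonneg ((v : C(Torus2, ℂ)) y)]

/-- The automorphism `Φ` multiplies weights by `κ`: it maps each character to a multiple of a
character of `κ` times its weight. -/
def ScalesWeights {α : ℝ} (Φ : isometricAut α) (κ : ℝ) : Prop :=
  ∀ k (hk : 0 ≤ weight α k), ∃ l, weight α l = κ * weight α k ∧
    ∃ a : ℂ, (Φ.1 (analyticChar k hk) : C(Torus2, ℂ)) = a • torusChar l

theorem weight_one_zero (α : ℝ) : weight α (1, 0) = 1 := by simp [weight_apply]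

theorem weight_zero_one (α : ℝ) : weight α (0, 1) = α := by simp [weight_apply]

theorem isometricAut_analyticChar_ne_zero {α : ℝ} (Φ : isometricAut α) {k : ℤ × ℤ}
    (hk : 0 ≤ weight α k) : (Φ.1 (analyticChar k hk) : C(Torus2, ℂ)) ≠ 0 := by
  rw [← norm_ne_zero_iff, norm_coe_isometricAut]
  exact norm_ne_zero_iff.2 (torusChar_ne_zero k)

theorem exists_scalesWeights {α : ℝ} (hpos : 0 < α) (hirr : Irrational α) (Φ : isometricAut α) :
    ∃ κ : ℝ, 0 < κ ∧ ScalesWeights Φ κ := by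
  classical
  let u : ℤ × ℤ → C(Torus2, ℂ) := fun k =>
    if hk : 0 ≤ weight α k then (Φ.1 (analyticChar k hk) : C(Torus2, ℂ)) else 0
  have hu : ∀ k (hk : 0 ≤ weight α k), u k = (Φ.1 (analyticChar k hk) : C(Torus2, ℂ)) :=
    fun k hk => dif_pos hk
  obtain ⟨κ, hκ⟩ := exists_scaling_of_unimodular hirr u
    (fun k hk => by rw [hu k hk]; exact Subtype.property _)
    (by
      have h0 : 0 ≤ weight α 0 := by simp
      rw [hu 0 h0]
      have h1 : (analyticChar 0 h0 : bigDiscAlgebra α) = 1 := Subtype.ext torusChar_zero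
      rw [h1, map_one]
      rfl)
    (fun k l hk hl => by
      have hkl : 0 ≤ weight α (k + l) := by rw [map_add]; exact add_nonneg hk hl
      rw [hu k hk, hu l hl, hu _ hkl]
      have h1 : (analyticChar (k + l) hkl : bigDiscAlgebra α) =
          analyticChar k hk * analyticChar l hl := Subtype.ext (torusChar_add k l)
      rw [h1, map_mul]
      rfl)
    (fun k hk x => by rw [hu k hk]; exact norm_isometricAut_analyticChar hpos Φ hk x)
  have hs : ScalesWeights Φ κ := fun k hk => by
    obtain ⟨l, hl, a, ha⟩ := hκ k hk
    exact ⟨l, hl, a, by rw [← hu k hk, ha]⟩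
  refine ⟨κ, ?_, hs⟩
  have hw : 0 ≤ weight α (1, 0) := by rw [weight_one_zero]; exact zero_le_one
  obtain ⟨l, hl, a, ha⟩ := hs (1, 0) hw
  rw [weight_one_zero, mul_one] at hl
  have ha0 : a ≠ 0 := fun h =>
    isometricAut_analyticChar_ne_zero Φ hw (by rw [ha, h, zero_smul])
  have h1 : 0 ≤ weight α l := weight_nonneg_of_smul_mem ha0 (ha ▸ Subtype.property _)
  refine lt_of_le_of_ne (hl ▸ h1) fun h0 => ?_
  -- If `κ = 0`, then a nonconstant character is mapped to a constant.
  have hl0 : l = 0 := weight_injective hirr (by rw [hl, ← h0, map_zero])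
  rw [hl0, torusChar_zero] at ha
  have h2 : analyticChar (1, 0) hw = a • (1 : bigDiscAlgebra α) := by
    apply Φ.1.injective
    rw [map_smul, map_one]
    exact Subtype.ext ha
  have h3 : torusChar (1, 0) = a • torusChar 0 := by
    rw [torusChar_zero]
    exact congrArg Subtype.val h2
  have h4 := smul_torusChar_injective one_ne_zero ((one_smul ℂ _).trans h3)
  simp at h4

namespace ScalesWeights

variable {α κ κ' : ℝ} {Φ Ψ : isometricAut α}

theorem one : ScalesWeights (1 : isometricAut α) 1 := fun k _ =>
  ⟨k, (one_mul _).symm, 1, (one_smul ℂ _).symm⟩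

theorem mul (h : ScalesWeights Φ κ) (h' : ScalesWeights Ψ κ') (hκ' : 0 ≤ κ') :
    ScalesWeights (Φ * Ψ) (κ * κ') := fun k hk => by
  obtain ⟨l, hl, a, ha⟩ := h' k hk
  have hl0 : 0 ≤ weight α l := hl ▸ mul_nonneg hκ' hk
  obtain ⟨m, hm, b, hb⟩ := h l hl0
  refine ⟨m, by rw [hm, hl, mul_assoc], a * b, ?_⟩
  have h1 : Ψ.1 (analyticChar k hk) = a • analyticChar l hl0 := Subtype.ext ha
  have h2 : (Φ * Ψ).1 (analyticChar k hk) = Φ.1 (Ψ.1 (analyticChar k hk)) := rfl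
  rw [h2, h1, map_smul, mul_smul, ← hb]
  rfl

theorem unique (h : ScalesWeights Φ κ) (h' : ScalesWeights Φ κ') : κ = κ' := by
  have hw : 0 ≤ weight α (1, 0) := by rw [weight_one_zero]; exact zero_le_one
  obtain ⟨l, hl, a, ha⟩ := h (1, 0) hw
  obtain ⟨m, hm, b, hb⟩ := h' (1, 0) hw
  have ha0 : a ≠ 0 := fun h =>
    isometricAut_analyticChar_ne_zero Φ hw (by rw [ha, h, zero_smul])
  rw [weight_one_zero, mul_one] at hl hm
  rw [← hl, ← hm, smul_torusChar_injective ha0 (ha.symm.trans hb)]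

/-- An automorphism that preserves weights is a rotation. -/
theorem exists_eq_torusTranslate (hpos : 0 < α) (hirr : Irrational α) (h : ScalesWeights Φ 1) :
    ∃ c, ∀ f : bigDiscAlgebra α, (Φ.1 f : C(Torus2, ℂ)) = torusTranslate c f := by
  have hmul : ∀ k (hk : 0 ≤ weight α k), ∃ a : Circle,
      (Φ.1 (analyticChar k hk) : C(Torus2, ℂ)) = (a : ℂ) • torusChar k := fun k hk => by
    obtain ⟨l, hl, a, ha⟩ := h k hk
    rw [one_mul] at hl
    rw [weight_injective hirr hl] at ha
    have h1 := norm_coe_isometricAut Φ (analyticChar k hk)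
    rw [ha, norm_smul, norm_torusChar, mul_one] at h1
    exact ⟨⟨a, mem_sphere_zero_iff_norm.2 (h1.trans (norm_torusChar k))⟩, ha⟩
  have hw1 : 0 ≤ weight α (1, 0) := by rw [weight_one_zero]; exact zero_le_one
  have hw2 : 0 ≤ weight α (0, 1) := by rw [weight_zero_one]; exact hpos.le
  obtain ⟨c₁, hc₁⟩ := hmul (1, 0) hw1
  obtain ⟨c₂, hc₂⟩ := hmul (0, 1) hw2
  set c : Torus2 := (c₁, c₂) with hc
  have hTmul : ∀ f g, torusTranslate c (f * g) = torusTranslate c f * torusTranslate c g :=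
    fun _ _ => rfl
  have hadd : ∀ k l (hk : 0 ≤ weight α k) (hl : 0 ≤ weight α l) (hkl : 0 ≤ weight α (k + l)),
      (Φ.1 (analyticChar (k + l) hkl) : C(Torus2, ℂ)) =
        Φ.1 (analyticChar k hk) * Φ.1 (analyticChar l hl) := fun k l hk hl hkl => by
    have h1 : (analyticChar (k + l) hkl : bigDiscAlgebra α) =
        analyticChar k hk * analyticChar l hl := Subtype.ext (torusChar_add k l)
    rw [h1, map_mul]
    rfl
  -- First the characters with nonnegative exponents; the others of nonnegative weight are
  -- quotients of these.
  have hwn : ∀ m n : ℕ, 0 ≤ weight α (m, n) := fun m n => by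
    rw [weight_apply]; push_cast; positivity
  have hnat : ∀ m n : ℕ, (Φ.1 (analyticChar (m, n) (hwn m n)) : C(Torus2, ℂ)) =
      torusTranslate c (torusChar (m, n)) := by
    intro m n
    induction m with
    | zero =>
      induction n with
      | zero =>
        have h1 : (analyticChar ((0 : ℕ), (0 : ℕ)) (hwn 0 0) : bigDiscAlgebra α) = 1 :=
          Subtype.ext torusChar_zero
        rw [h1, map_one]
        exact (congrArg (torusTranslate c) torusChar_zero).symm
      | succ n ih =>
        have h1 : (((0 : ℕ) : ℤ), ((n + 1 : ℕ) : ℤ)) = (((0 : ℕ) : ℤ), (n : ℤ)) + (0, 1) := by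
          simp
        have h2 := hadd _ _ (hwn 0 n) hw2 (by rw [← h1]; exact hwn 0 (n + 1))
        simp only [h1]
        rw [h2, ih, hc₂, torusChar_add, hTmul, torusTranslate_torusChar c (0, 1)]
        simp [torusChar_apply, hc]
    | succ m ih =>
      have h1 : (((m + 1 : ℕ) : ℤ), (n : ℤ)) = ((m : ℤ), (n : ℤ)) + (1, 0) := by
        simp
      have h2 := hadd _ _ (hwn m n) hw1 (by rw [← h1]; exact hwn (m + 1) n)
      simp only [h1]
      rw [h2, ih, hc₁, torusChar_add, hTmul, torusTranslate_torusChar c (1, 0)]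
      simp [torusChar_apply, hc]
  have hall : ∀ k (hk : 0 ≤ weight α k), (Φ.1 (analyticChar k hk) : C(Torus2, ℂ)) =
      torusTranslate c (torusChar k) := by
    intro k hk
    set l : ℤ × ℤ := (((-k.1).toNat : ℤ), ((-k.2).toNat : ℤ)) with hl
    have hkl : k + l = ((k.1.toNat : ℤ), (k.2.toNat : ℤ)) := by
      ext <;> simp [hl] <;> omega
    have h1 := hadd k l hk (hwn _ _) (by rw [hkl]; exact hwn _ _)
    simp only [hkl] at h1
    rw [hnat, hnat, ← hkl, torusChar_add, hTmul] at h1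
    have h2 : torusTranslate c (torusChar l) * torusTranslate c (torusChar (-l)) = 1 := by
      rw [← hTmul, ← torusChar_add, add_neg_cancel, torusChar_zero]
      rfl
    have h3 : torusTranslate c (torusChar k) * torusTranslate c (torusChar l) *
        torusTranslate c (torusChar (-l)) = (Φ.1 (analyticChar k hk) : C(Torus2, ℂ)) *
          torusTranslate c (torusChar l) * torusTranslate c (torusChar (-l)) :=
      congrArg (· * torusTranslate c (torusChar (-l))) h1
    rw [mul_assoc, mul_assoc, h2, mul_one, mul_one] at h3
    exact h3.symm
  refine ⟨c, ?_⟩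
  have h1 := eq_of_eq_on_analyticChar
    (S := (bigDiscAlgebra α).val.toLinearMap ∘ₗ Φ.1.toLinearMap)
    (T := (ContinuousMap.compRightAlgHom ℂ ℂ ⟨fun x => c * x, by fun_prop⟩).toLinearMap ∘ₗ
      (bigDiscAlgebra α).val.toLinearMap)
    (continuous_subtype_val.comp (show Isometry Φ.1 from Φ.2).continuous)
    ((ContinuousMap.continuous_precomp _).comp continuous_subtype_val) hall
  exact fun f => LinearMap.congr_fun h1 f

end ScalesWeights

/-- The homomorphism sending an isometric automorphism to the factor by which it multiplies
weights. -/
noncomputable def scalingHom {α : ℝ} (hpos : 0 < α) (hirr : Irrational α) :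
    isometricAut α →* ℝ where
  toFun Φ := (exists_scalesWeights hpos hirr Φ).choose
  map_one' := (exists_scalesWeights hpos hirr 1).choose_spec.2.unique .one
  map_mul' Φ Ψ := (exists_scalesWeights hpos hirr (Φ * Ψ)).choose_spec.2.unique
    ((exists_scalesWeights hpos hirr Φ).choose_spec.2.mul
      (exists_scalesWeights hpos hirr Ψ).choose_spec.2
      (exists_scalesWeights hpos hirr Ψ).choose_spec.1.le)

theorem scalesWeights_scalingHom {α : ℝ} (hpos : 0 < α) (hirr : Irrational α)
    (Φ : isometricAut α) : ScalesWeights Φ (scalingHom hpos hirr Φ) :=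
  (exists_scalesWeights hpos hirr Φ).choose_spec.2

theorem scalingHom_pos {α : ℝ} (hpos : 0 < α) (hirr : Irrational α) (Φ : isometricAut α) :
    0 < scalingHom hpos hirr Φ :=
  (exists_scalesWeights hpos hirr Φ).choose_spec.1

/-! ### Automorphisms given by homeomorphisms of the torus -/

/-- The isometric automorphism `f ↦ f ∘ φ` given by a homeomorphism `φ` of the torus such that
composition with `φ` and `φ⁻¹` maps the algebra to itself. -/
noncomputable def compAut {α : ℝ} (φ : Torus2 ≃ₜ Torus2)
    (h : ∀ k, 0 ≤ weight α k → (torusChar k).comp (φ : C(Torus2, Torus2)) ∈ bigDiscAlgebra α)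
    (h' : ∀ k, 0 ≤ weight α k →
      (torusChar k).comp (φ.symm : C(Torus2, Torus2)) ∈ bigDiscAlgebra α) :
    isometricAut α where
  val :=
    { toFun := fun f => ⟨(f : C(Torus2, ℂ)).comp φ, comp_mem_bigDiscAlgebra _ h f.2⟩
      invFun := fun f => ⟨(f : C(Torus2, ℂ)).comp φ.symm, comp_mem_bigDiscAlgebra _ h' f.2⟩
      left_inv := fun f => by ext x; simp
      right_inv := fun f => by ext x; simp
      map_mul' := fun _ _ => rfl
      map_add' := fun _ _ => rfl
      commutes' := fun _ => rfl }
  property := by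
    refine Isometry.of_dist_eq fun f g => ?_
    rw [Subtype.dist_eq, Subtype.dist_eq, ContinuousMap.dist_eq_iSup, ContinuousMap.dist_eq_iSup]
    exact φ.surjective.iSup_comp (fun x => dist ((f : C(Torus2, ℂ)) x) ((g : C(Torus2, ℂ)) x))

theorem isometricAut_ext {α : ℝ} {Φ Ψ : isometricAut α}
    (h : ∀ (f : bigDiscAlgebra α) x, (Φ.1 f : C(Torus2, ℂ)) x = (Ψ.1 f : C(Torus2, ℂ)) x) :
    Φ = Ψ :=
  Subtype.ext (AlgEquiv.ext fun f => Subtype.ext (ContinuousMap.ext (h f)))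

theorem torusChar_comp_mulLeft_mem {α : ℝ} (c : Torus2) {k : ℤ × ℤ} (hk : 0 ≤ weight α k) :
    (torusChar k).comp (Homeomorph.mulLeft c : C(Torus2, Torus2)) ∈ bigDiscAlgebra α := by
  have h : (torusChar k).comp (Homeomorph.mulLeft c : C(Torus2, Torus2)) =
      torusChar k c • torusChar k := torusTranslate_torusChar c k
  rw [h]
  exact (bigDiscAlgebra α).smul_mem (torusChar_mem_bigDiscAlgebra hk) _

/-- The homomorphism sending `c` to the rotation by `c`. -/
noncomputable def rotationHom (α : ℝ) : Torus2 →* isometricAut α where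
  toFun c := compAut (Homeomorph.mulLeft c) (fun _ hk => torusChar_comp_mulLeft_mem c hk)
    (fun _ hk => by rw [Homeomorph.mulLeft_symm]; exact torusChar_comp_mulLeft_mem c⁻¹ hk)
  map_one' := isometricAut_ext fun f x =>
    congrArg (f : C(Torus2, ℂ)) (one_mul x)
  map_mul' c d := isometricAut_ext fun f x =>
    congrArg (f : C(Torus2, ℂ)) (by
      change c * d * x = d * (c * x)
      rw [mul_comm c, mul_assoc])

theorem rotationHom_apply {α : ℝ} (c : Torus2) (f : bigDiscAlgebra α) (x : Torus2) :
    ((rotationHom α c).1 f : C(Torus2, ℂ)) x = (f : C(Torus2, ℂ)) (c * x) := rfl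

theorem isRotationBy_rotationHom {α : ℝ} (c : Torus2) : IsRotationBy (rotationHom α c) c :=
  fun _ _ _ => rfl

theorem rotationHom_injective {α : ℝ} (hpos : 0 < α) : Function.Injective (rotationHom α) := by
  refine (injective_iff_map_eq_one _).2 fun c hc => ?_
  have key : ∀ k (hk : 0 ≤ weight α k), torusChar k c = 1 := fun k hk => by
    have h1 := rotationHom_apply c (analyticChar k hk) 1
    rw [hc, mul_one] at h1
    exact h1.symm.trans (torusChar_apply_one k)
  have h1 := key (1, 0) (by rw [weight_one_zero]; exact zero_le_one)
  have h2 := key (0, 1) (by rw [weight_zero_one]; exact hpos.le)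
  exact eq_one_of_torusChar_eq_one h1 h2

theorem scalesWeights_rotationHom {α : ℝ} (c : Torus2) : ScalesWeights (rotationHom α c) 1 :=
  fun k _ => ⟨k, (one_mul _).symm, torusChar k c, torusTranslate_torusChar c k⟩

/-- The rotations are exactly the automorphisms that preserve weights. -/
theorem exists_rotationHom_eq {α : ℝ} (hpos : 0 < α) (hirr : Irrational α) {Φ : isometricAut α}
    (h : scalingHom hpos hirr Φ = 1) : ∃ c, rotationHom α c = Φ := by
  obtain ⟨c, hc⟩ := (h ▸ scalesWeights_scalingHom hpos hirr Φ).exists_eq_torusTranslate hpos hirr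
  exact ⟨c, isometricAut_ext fun f x => (DFunLike.congr_fun (hc f) x).symm⟩

/-! ### Multipliers of the lattice `ℤ + αℤ` -/

/-- The vector `(1, α)` is an eigenvector of the integer matrix `M` with eigenvalue `κ`. This
expresses that `κ (ℤ + αℤ) ⊆ ℤ + αℤ`. -/
def IsMultiplierMatrix (α : ℝ) (M : Matrix (Fin 2) (Fin 2) ℤ) (κ : ℝ) : Prop :=
  M 0 0 + α * M 0 1 = κ ∧ M 1 0 + α * M 1 1 = κ * α

namespace IsMultiplierMatrix

variable {α κ κ' : ℝ} {M N : Matrix (Fin 2) (Fin 2) ℤ}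

theorem one (α : ℝ) : IsMultiplierMatrix α 1 1 := by simp [IsMultiplierMatrix]

theorem mul (h : IsMultiplierMatrix α M κ) (h' : IsMultiplierMatrix α N κ') :
    IsMultiplierMatrix α (M * N) (κ * κ') := by
  obtain ⟨h1, h2⟩ := h
  obtain ⟨h3, h4⟩ := h'
  constructor <;> simp only [Matrix.mul_apply, Fin.sum_univ_two] <;> push_cast
  · linear_combination M 0 0 * h3 + M 0 1 * h4 + κ' * h1
  · linear_combination M 1 0 * h3 + M 1 1 * h4 + κ' * h2

theorem inv {B : Matrix.GeneralLinearGroup (Fin 2) ℤ} (hκ : κ ≠ 0)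
    (h : IsMultiplierMatrix α B.1 κ) : IsMultiplierMatrix α B⁻¹.1 κ⁻¹ := by
  obtain ⟨h1, h2⟩ := h
  have hB : ∀ i j, B⁻¹.1 i 0 * B.1 0 j + B⁻¹.1 i 1 * B.1 1 j =
      (1 : Matrix (Fin 2) (Fin 2) ℤ) i j := fun i j => by
    rw [← Fin.sum_univ_two fun k => B⁻¹.1 i k * B.1 k j, ← Matrix.mul_apply, ← Units.val_mul,
      inv_mul_cancel, Units.val_one]
  have hB' : ∀ i j, (B⁻¹.1 i 0 * B.1 0 j + B⁻¹.1 i 1 * B.1 1 j : ℝ) =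
      ((1 : Matrix (Fin 2) (Fin 2) ℤ) i j : ℤ) := fun i j => by exact_mod_cast hB i j
  have h00 := hB' 0 0
  have h01 := hB' 0 1
  have h10 := hB' 1 0
  have h11 := hB' 1 1
  simp only [Matrix.one_apply, Fin.isValue, if_true, zero_ne_one, one_ne_zero, if_false,
    Int.cast_one, Int.cast_zero] at h00 h01 h10 h11
  constructor
  · refine eq_inv_of_mul_eq_one_left ?_
    linear_combination -(B⁻¹.1 0 0) * h1 - (B⁻¹.1 0 1) * h2 + h00 + α * h01
  · rw [inv_mul_eq_div, eq_div_iff hκ]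
    linear_combination -(B⁻¹.1 1 0) * h1 - (B⁻¹.1 1 1) * h2 + h10 + α * h11

theorem eq_one (hirr : Irrational α) (h : IsMultiplierMatrix α M 1) : M = 1 := by
  have h1 : ((M 0 0, M 0 1) : ℤ × ℤ) = (1, 0) := weight_injective hirr (by
    rw [weight_one_zero, weight_apply]; exact h.1)
  have h2 : ((M 1 0, M 1 1) : ℤ × ℤ) = (0, 1) := weight_injective hirr (by
    rw [weight_zero_one, weight_apply, h.2, one_mul])
  simp only [Prod.mk.injEq] at h1 h2
  ext i j
  fin_cases i <;> fin_cases j <;> simp [h1, h2]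

/-- The characteristic equation of the eigenvalue. -/
theorem charpoly_eq (h : IsMultiplierMatrix α M κ) :
    κ ^ 2 - ((M 0 0 + M 1 1 : ℤ) : ℝ) * κ + (M.det : ℤ) = 0 := by
  rw [Matrix.det_fin_two]
  push_cast
  linear_combination (-(κ - M 1 1)) * h.1 - M 0 1 * h.2

/-- Units of the ring of multipliers of `ℤ + αℤ` do not accumulate at `1`: by the characteristic
equation, `κ + κ⁻¹` or `κ - κ⁻¹` is an integer. -/
theorem not_mem_Ioo {B : Matrix.GeneralLinearGroup (Fin 2) ℤ}
    (h : IsMultiplierMatrix α B.1 κ) : κ ∉ Set.Ioo (1 : ℝ) (3 / 2) := by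
  rintro ⟨h1, h2⟩
  have hc := h.charpoly_eq
  have hu : IsUnit B.1.det := (Matrix.isUnit_iff_isUnit_det _).1 B.isUnit
  generalize B.1 0 0 + B.1 1 1 = t at hc
  rcases Int.isUnit_iff.1 hu with hd | hd
  · rw [hd] at hc
    push_cast at hc
    have h3 : (2 : ℝ) < t := by nlinarith
    have h4 : (t : ℝ) < 3 := by nlinarith
    have h3' : 2 < t := by exact_mod_cast h3
    have h4' : t < 3 := by exact_mod_cast h4
    omega
  · rw [hd] at hc
    push_cast at hc
    have h3 : (0 : ℝ) < t := by nlinarith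
    have h4 : (t : ℝ) < 1 := by nlinarith
    have h3' : 0 < t := by exact_mod_cast h3
    have h4' : t < 1 := by exact_mod_cast h4
    omega

/-- If `α` is not a quadratic irrational, the only positive unit multiplier is `1`. -/
theorem eq_one_of_not_quadratic (hirr : Irrational α) (hq : ¬ IsQuadraticIrrational α)
    {B : Matrix.GeneralLinearGroup (Fin 2) ℤ} (hκ : 0 < κ) (h : IsMultiplierMatrix α B.1 κ) :
    κ = 1 := by
  obtain ⟨h1, h2⟩ := h
  have hb : B.1 0 1 = 0 := by
    by_contra hb
    refine hq ⟨hirr, B.1 0 1, B.1 0 0 - B.1 1 1, -B.1 1 0, hb, ?_⟩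
    push_cast
    linear_combination α * h1 - h2
  have hd : IsUnit B.1.det := (Matrix.isUnit_iff_isUnit_det _).1 B.isUnit
  rw [Matrix.det_fin_two, hb, zero_mul, sub_zero] at hd
  rw [hb] at h1
  simp only [Int.cast_zero, mul_zero, add_zero] at h1
  rcases Int.isUnit_iff.1 (isUnit_of_mul_isUnit_left hd) with h3 | h3
  · rw [← h1, h3, Int.cast_one]
  · rw [h3] at h1
    push_cast at h1
    linarith

end IsMultiplierMatrix

/-- For a quadratic irrational, Pell's equation provides a nontrivial positive unit multiplier. -/
theorem exists_multiplier_ne_one {α : ℝ} (hq : IsQuadraticIrrational α) :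
    ∃ (B : Matrix.GeneralLinearGroup (Fin 2) ℤ) (κ : ℝ), 0 < κ ∧ κ ≠ 1 ∧
      IsMultiplierMatrix α B.1 κ := by
  obtain ⟨hirr, a, b, c, ha, habc⟩ := hq
  set β : ℝ := 2 * a * α + b with hβ
  have hD : β ^ 2 = ((b ^ 2 - 4 * a * c : ℤ) : ℝ) := by
    rw [hβ]; push_cast; linear_combination 4 * a * habc
  have hβr : ∀ r : ℤ, β ≠ r := fun r hr => by
    have h1 : ((2 * a, 0) : ℤ × ℤ).1 ≠ 0 := by simpa using ha
    have h2 : weight α (b - r, 2 * a) = weight α 0 := by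
      rw [map_zero, weight_apply]; push_cast; linear_combination hr
    have h3 := congrArg Prod.snd (weight_injective hirr h2)
    exact ha (by simpa using h3)
  have hβ0 : β ≠ 0 := by simpa using hβr 0
  have hDpos : 0 < b ^ 2 - 4 * a * c := by
    have h1 : (0 : ℝ) < ((b ^ 2 - 4 * a * c : ℤ) : ℝ) := by rw [← hD]; positivity
    exact_mod_cast h1
  have hDsq : ¬ IsSquare (b ^ 2 - 4 * a * c) := by
    rintro ⟨r, hr⟩
    rw [hr] at hD
    have h1 : (β - r) * (β + r) = 0 := by push_cast at hD; linear_combination hD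
    rcases mul_eq_zero.1 h1 with h | h
    · exact hβr r (by linarith)
    · exact hβr (-r) (by push_cast; linarith)
  obtain ⟨x, y, hxy, hy⟩ := Pell.exists_of_not_isSquare hDpos hDsq
  rw [← sq_abs x] at hxy
  set X := |x| with hX
  have hX0 : 0 ≤ X := abs_nonneg x
  let M : Matrix (Fin 2) (Fin 2) ℤ := !![X + b * y, 2 * a * y; -2 * c * y, X - b * y]
  have hM : M.det = 1 := by
    rw [Matrix.det_fin_two_of]; linear_combination hxy
  have hMu : IsUnit M := (Matrix.isUnit_iff_isUnit_det _).2 (by rw [hM]; exact isUnit_one)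
  refine ⟨hMu.unit, X + y * β, ?_, ?_, ?_, ?_⟩
  · have h1 : (X : ℝ) ^ 2 - (y * β) ^ 2 = 1 := by
      rw [mul_pow, hD]; exact_mod_cast (by linear_combination hxy)
    have h2 : (0 : ℝ) ≤ X := by exact_mod_cast hX0
    by_contra! h3
    nlinarith
  · intro h1
    have h2 : weight α (X + b * y, 2 * a * y) = weight α (1, 0) := by
      rw [weight_one_zero, weight_apply, ← h1, hβ]; push_cast; ring
    have h3 := congrArg Prod.snd (weight_injective hirr h2)
    simp [ha, hy] at h3
  · simp [M, hβ]; ring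
  · simp [M, hβ]; linear_combination (-2 * y : ℝ) * habc

/-- The logarithms of the positive unit multipliers of `ℤ + αℤ`. -/
def logMultipliers (α : ℝ) : AddSubgroup ℝ where
  carrier := {t | ∃ B : Matrix.GeneralLinearGroup (Fin 2) ℤ,
    IsMultiplierMatrix α B.1 (Real.exp t)}
  zero_mem' := ⟨1, by rw [Real.exp_zero]; exact .one α⟩
  add_mem' := by
    rintro s t ⟨B, hB⟩ ⟨C, hC⟩
    exact ⟨B * C, by rw [Real.exp_add]; exact hB.mul hC⟩
  neg_mem' := by
    rintro t ⟨B, hB⟩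
    exact ⟨B⁻¹, by rw [Real.exp_neg]; exact hB.inv (Real.exp_pos t).ne'⟩

theorem exists_logMultipliers_eq_closure (α : ℝ) :
    ∃ t, logMultipliers α = AddSubgroup.closure {t} := by
  refine (logMultipliers α).dense_or_cyclic.resolve_left fun hd => ?_
  obtain ⟨t, ⟨B, hB⟩, h0, h1⟩ := hd.exists_between (Real.log_pos (by norm_num : (1 : ℝ) < 3 / 2))
  refine hB.not_mem_Ioo ⟨Real.one_lt_exp_iff.2 h0, ?_⟩
  rwa [← Real.lt_log_iff_exp_lt (by norm_num)]

/-- The positive unit multipliers of `ℤ + αℤ`, for a quadratic irrational `α`, are the powers of a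
fundamental one. -/
theorem exists_fundamental_multiplier {α : ℝ} (hq : IsQuadraticIrrational α) :
    ∃ (B : Matrix.GeneralLinearGroup (Fin 2) ℤ) (κ : ℝ), 0 < κ ∧ κ ≠ 1 ∧
      IsMultiplierMatrix α B.1 κ ∧
      ∀ (C : Matrix.GeneralLinearGroup (Fin 2) ℤ) (κ' : ℝ), 0 < κ' →
        IsMultiplierMatrix α C.1 κ' → ∃ n : ℤ, κ' = κ ^ n := by
  obtain ⟨t, ht⟩ := exists_logMultipliers_eq_closure α
  obtain ⟨B, hB⟩ : t ∈ logMultipliers α := ht ▸ AddSubgroup.subset_closure rfl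
  have hpow : ∀ (C : Matrix.GeneralLinearGroup (Fin 2) ℤ) (κ' : ℝ), 0 < κ' →
      IsMultiplierMatrix α C.1 κ' → ∃ n : ℤ, κ' = Real.exp t ^ n := by
    intro C κ' hκ' hC
    have h1 : Real.log κ' ∈ logMultipliers α := ⟨C, by rwa [Real.exp_log hκ']⟩
    rw [ht] at h1
    obtain ⟨n, hn⟩ := AddSubgroup.mem_closure_singleton.1 h1
    exact ⟨n, by rw [← Real.rpow_intCast, ← Real.exp_mul, mul_comm, ← zsmul_eq_mul, hn,
      Real.exp_log hκ']⟩
  refine ⟨B, Real.exp t, Real.exp_pos t, fun h1 => ?_, hB, hpow⟩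
  obtain ⟨C, κ', hκ', hne, hC⟩ := exists_multiplier_ne_one hq
  obtain ⟨n, hn⟩ := hpow C κ' hκ' hC
  exact hne (by rw [hn, h1, one_zpow])

theorem ScalesWeights.exists_isMultiplierMatrix {α κ : ℝ} (hpos : 0 < α) {Φ : isometricAut α}
    (h : ScalesWeights Φ κ) : ∃ M, IsMultiplierMatrix α M κ := by
  obtain ⟨l, hl, -⟩ := h (1, 0) (by rw [weight_one_zero]; exact zero_le_one)
  obtain ⟨m, hm, -⟩ := h (0, 1) (by rw [weight_zero_one]; exact hpos.le)
  rw [weight_one_zero, mul_one, weight_apply] at hl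
  rw [weight_zero_one, weight_apply] at hm
  exact ⟨!![l.1, l.2; m.1, m.2], by simpa using hl, by simpa using hm⟩

/-- The scaling factors of isometric automorphisms are unit multipliers of `ℤ + αℤ`. -/
theorem exists_isMultiplierMatrix_scalingHom {α : ℝ} (hpos : 0 < α) (hirr : Irrational α)
    (Φ : isometricAut α) : ∃ B : Matrix.GeneralLinearGroup (Fin 2) ℤ,
      IsMultiplierMatrix α B.1 (scalingHom hpos hirr Φ) := by
  obtain ⟨M, hM⟩ := (scalesWeights_scalingHom hpos hirr Φ).exists_isMultiplierMatrix hpos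
  obtain ⟨N, hN⟩ := (scalesWeights_scalingHom hpos hirr Φ⁻¹).exists_isMultiplierMatrix hpos
  have h1 : M * N = 1 := IsMultiplierMatrix.eq_one hirr (by
    have := hM.mul hN
    rwa [← map_mul, mul_inv_cancel, map_one] at this)
  have h2 : N * M = 1 := IsMultiplierMatrix.eq_one hirr (by
    have := hN.mul hM
    rwa [← map_mul, inv_mul_cancel, map_one] at this)
  exact ⟨⟨M, N, h1, h2⟩, hM⟩

/-! ### Automorphisms given by matrices and the semidirect product -/

/-- The toral automorphism given by `B`, as a homeomorphism. -/
noncomputable def toralHomeomorph (B : Matrix.GeneralLinearGroup (Fin 2) ℤ) :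
    Torus2 ≃ₜ Torus2 where
  toEquiv := (toralAut B).toEquiv
  continuous_toFun := by
    change Continuous (toralMap B.1)
    exact ((continuous_fst.zpow _).mul (continuous_snd.zpow _)).prodMk
      ((continuous_fst.zpow _).mul (continuous_snd.zpow _))
  continuous_invFun := by
    change Continuous (toralMap B⁻¹.1)
    exact ((continuous_fst.zpow _).mul (continuous_snd.zpow _)).prodMk
      ((continuous_fst.zpow _).mul (continuous_snd.zpow _))

theorem torusChar_toralMap (M : Matrix (Fin 2) (Fin 2) ℤ) (k : ℤ × ℤ) (x : Torus2) :
    torusChar k (toralMap M x) =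
      torusChar (k.1 * M 0 0 + k.2 * M 1 0, k.1 * M 0 1 + k.2 * M 1 1) x := by
  simp only [torusChar_apply, toralMap, mul_zpow, ← zpow_mul, zpow_add, mul_comm (M _ _)]
  rw [mul_mul_mul_comm]

theorem IsMultiplierMatrix.weight_eq {α κ : ℝ} {M : Matrix (Fin 2) (Fin 2) ℤ}
    (h : IsMultiplierMatrix α M κ) (k : ℤ × ℤ) :
    weight α (k.1 * M 0 0 + k.2 * M 1 0, k.1 * M 0 1 + k.2 * M 1 1) = κ * weight α k := by
  simp only [weight_apply]
  push_cast
  linear_combination k.1 * h.1 + k.2 * h.2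

theorem torusChar_comp_toralHomeomorph_mem {α κ : ℝ} (hκ : 0 < κ)
    {B : Matrix.GeneralLinearGroup (Fin 2) ℤ} (h : IsMultiplierMatrix α B.1 κ) {k : ℤ × ℤ}
    (hk : 0 ≤ weight α k) :
    (torusChar k).comp (toralHomeomorph B : C(Torus2, Torus2)) ∈ bigDiscAlgebra α := by
  have h1 : (torusChar k).comp (toralHomeomorph B : C(Torus2, Torus2)) =
      torusChar (k.1 * B.1 0 0 + k.2 * B.1 1 0, k.1 * B.1 0 1 + k.2 * B.1 1 1) :=
    ContinuousMap.ext fun x => torusChar_toralMap B.1 k x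
  rw [h1]
  exact torusChar_mem_bigDiscAlgebra (by rw [h.weight_eq]; exact mul_nonneg hκ.le hk)

/-- The isometric automorphism `f ↦ f ∘ ψ_B`, for a matrix `B` with eigenvector `(1, α)` of
positive eigenvalue. -/
noncomputable def matrixAut {α κ : ℝ} (hκ : 0 < κ) (B : Matrix.GeneralLinearGroup (Fin 2) ℤ)
    (h : IsMultiplierMatrix α B.1 κ) : isometricAut α :=
  compAut (toralHomeomorph B) (fun _ hk => torusChar_comp_toralHomeomorph_mem hκ h hk)
    (fun _ hk => torusChar_comp_toralHomeomorph_mem (B := B⁻¹) (inv_pos.2 hκ) (h.inv hκ.ne') hk)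

theorem scalesWeights_matrixAut {α κ : ℝ} (hκ : 0 < κ) (B : Matrix.GeneralLinearGroup (Fin 2) ℤ)
    (h : IsMultiplierMatrix α B.1 κ) : ScalesWeights (matrixAut hκ B h) κ := fun k _ =>
  ⟨_, h.weight_eq k, 1, by
    rw [one_smul]
    exact ContinuousMap.ext fun x => torusChar_toralMap B.1 k x⟩

/-- Composition with `ψ_B` conjugates the rotation by `ψ_B(c)` to the rotation by `c`. -/
theorem matrixAut_mul_rotationHom {α κ : ℝ} (hκ : 0 < κ)
    (B : Matrix.GeneralLinearGroup (Fin 2) ℤ) (h : IsMultiplierMatrix α B.1 κ) (c : Torus2) :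
    matrixAut hκ B h * rotationHom α (toralAut B c) = rotationHom α c * matrixAut hκ B h :=
  isometricAut_ext fun f x => congrArg (f : C(Torus2, ℂ)) (map_mul (toralAut B) c x).symm

theorem toralAut_inv (B : Matrix.GeneralLinearGroup (Fin 2) ℤ) :
    toralAut B⁻¹ = (toralAut B)⁻¹ := by
  ext1 c
  rfl

/-- Equivariance of a homomorphism under an automorphism extends to the powers. -/
theorem map_zpow_apply_eq_conj {N G : Type*} [Group N] [Group G] (f : N →* G) (a : MulAut N)
    (x : G) (h : ∀ c, f (a c) = x * f c * x⁻¹) (n : ℤ) (c : N) :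
    f ((a ^ n) c) = x ^ n * f c * (x ^ n)⁻¹ := by
  have hinv : ∀ c, f (a⁻¹ c) = x⁻¹ * f c * x := fun c => by
    have h1 := h (a⁻¹ c)
    rw [MulAut.apply_inv_self] at h1
    rw [h1]
    group
  induction n generalizing c with
  | zero => simp
  | succ n ih =>
    rw [zpow_add_one, MulAut.mul_apply, ih, h, zpow_add_one]
    group
  | pred n ih =>
    rw [zpow_sub_one, MulAut.mul_apply, ih, hinv, zpow_sub_one]
    group

theorem theorem4p7 (α : ℝ) (hpos : 0 < α) (hirr : Irrational α) :
    (¬ IsQuadraticIrrational α →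
      ∃ e : Torus2 ≃* isometricAut α, ∀ c : Torus2, IsRotationBy (e c) c) ∧
    (IsQuadraticIrrational α →
      ∃ A : Matrix.GeneralLinearGroup (Fin 2) ℤ, A ≠ 1 ∧
        ∃ e : TorusSemidirect A ≃* isometricAut α,
          ∀ c : Torus2, IsRotationBy (e (SemidirectProduct.inl c)) c) := by
  constructor
  · intro hq
    refine ⟨MulEquiv.ofBijective (rotationHom α) ⟨rotationHom_injective hpos, fun Φ => ?_⟩,
      isRotationBy_rotationHom⟩
    obtain ⟨B, hB⟩ := exists_isMultiplierMatrix_scalingHom hpos hirr Φ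
    exact exists_rotationHom_eq hpos hirr
      (hB.eq_one_of_not_quadratic hirr hq (scalingHom_pos hpos hirr Φ))
  · intro hq
    obtain ⟨B, κ, hκ, hκ1, hB, hpow⟩ := exists_fundamental_multiplier hq
    set Ψ := matrixAut hκ B hB with hΨ
    have hΨκ : scalingHom hpos hirr Ψ = κ :=
      (scalesWeights_scalingHom hpos hirr Ψ).unique (scalesWeights_matrixAut hκ B hB)
    have hR : ∀ c, scalingHom hpos hirr (rotationHom α c) = 1 := fun c =>
      (scalesWeights_scalingHom hpos hirr _).unique (scalesWeights_rotationHom c)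
    have hconj : ∀ c, rotationHom α (toralAut B⁻¹ c) = Ψ * rotationHom α c * Ψ⁻¹ := fun c => by
      have h1 := matrixAut_mul_rotationHom hκ B hB ((toralAut B)⁻¹ c)
      rw [MulAut.apply_inv_self] at h1
      rw [toralAut_inv, eq_mul_inv_iff_mul_eq, hΨ, h1]
    refine ⟨B⁻¹, fun h1 => hκ1 ?_, ?_⟩
    · have h2 := hB.1
      rw [inv_eq_one.1 h1] at h2
      simpa using h2.symm
    let E : TorusSemidirect B⁻¹ →* isometricAut α :=
      SemidirectProduct.lift (rotationHom α) (zpowersHom _ Ψ) fun g => MonoidHom.ext fun c =>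
        map_zpow_apply_eq_conj (rotationHom α) (toralAut B⁻¹) Ψ hconj g.toAdd c
    have hE : ∀ g, E g = rotationHom α g.left * Ψ ^ g.right.toAdd := fun g => rfl
    have hEinj : Function.Injective E := by
      refine (injective_iff_map_eq_one E).2 fun g hg => ?_
      rw [hE] at hg
      have h1 := congrArg (scalingHom hpos hirr) hg
      rw [map_mul, map_zpow, hR, hΨκ, one_mul, map_one] at h1
      have h2 : g.right.toAdd = 0 := (zpow_eq_one_iff_right₀ hκ.le hκ1).1 h1
      rw [h2, zpow_zero, mul_one] at hg
      exact SemidirectProduct.ext (rotationHom_injective hpos (hg.trans (map_one _).symm)) h2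
    have hEsurj : Function.Surjective E := fun Φ => by
      obtain ⟨C, hC⟩ := exists_isMultiplierMatrix_scalingHom hpos hirr Φ
      obtain ⟨n, hn⟩ := hpow C _ (scalingHom_pos hpos hirr Φ) hC
      obtain ⟨c, hc⟩ := exists_rotationHom_eq hpos hirr (Φ := Φ * Ψ ^ (-n)) (by
        rw [map_mul, map_zpow, hn, hΨκ, ← zpow_add₀ hκ.ne', add_neg_cancel, zpow_zero])
      refine ⟨⟨c, Multiplicative.ofAdd n⟩, ?_⟩
      rw [hE]
      change rotationHom α c * Ψ ^ n = Φ
      rw [hc, zpow_neg, inv_mul_cancel_right]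
    refine ⟨MulEquiv.ofBijective E ⟨hEinj, hEsurj⟩, fun c => ?_⟩
    have h1 : E (SemidirectProduct.inl c) = rotationHom α c := SemidirectProduct.lift_inl _ _ _ c
    change IsRotationBy (E (SemidirectProduct.inl c)) c
    rw [h1]
    exact isRotationBy_rotationHom c
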